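/- A graphical instance consists of a finite simple graph $G=(V,E)$, whose vertices are the agents and whose edges are the items, together with values $u_i(e)\ge 0$ for $i\in V$, $e\in E$, such that $u_i(e)=0$ whenever $i$ is not an endpoint of $e$; utilities are additive, $u_i(S)=\sum_{e\in S}u_i(e)$ for $S\subseteq E$. It is a $\{0,1\}$-graphical instance if $u_i(e)\in\{0,1\}$ for all $i\in V$ and $e\in E$. An allocation is a partition $(\Phi_i)_{i\in V}$ of $E$ into (possibly empty) bundles, one for each agent; it is envy-free if $u_i(\Phi_i)\ge u_i(\Phi_j)$ for all $i,j\in V$. Theorem. There is a deterministic polynomial-time algorithm that, given a $\{0,1\}$-graphical instance (the number of agents, and the list of the edges, each with the values of its two endpoints for it), decides whether the instance has an envy-free allocation, and outputs one if it does. -/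

import Mathlib

open scoped NNReal

namespace FairDivision

/-! ### Fair division with additive valuations -/

section Model

variable {N M : Type} [Fintype M] [DecidableEq N]

/-- The additive utility of agent `i` for the set `S` of items, where `u i g` is the value of the
single item `g` for agent `i`. -/
def utility (u : N → M → ℝ≥0) (i : N) (S : Finset M) : ℝ≥0 := ∑ g ∈ S, u i g

/-- An allocation is a partition of the items into one (possibly empty) bundle per agent; it is
given by the function `Φ` that sends each item to its recipient. This is the bundle of agent `i`. -/
def bundle (Φ : M → N) (i : N) : Finset M := Finset.univ.filter fun g => Φ g = i

/-- Every agent values its own bundle at least as much as the bundle of any agent. -/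
def IsEnvyFree (u : N → M → ℝ≥0) (Φ : M → N) : Prop :=
  ∀ i j : N, utility u i (bundle Φ j) ≤ utility u i (bundle Φ i)

end Model

/-! ### Graphical instances -/

/-- A graphical instance: the agents are the vertices and the items are the edges of a simple
graph, and an agent can have a positive value only for the edges incident to it. -/
structure GraphicalInstance where
  n : ℕ
  G : SimpleGraph (Fin n)
  u : Fin n → G.edgeSet → ℝ≥0
  u_eq_zero : ∀ (i : Fin n) (e : G.edgeSet), i ∉ (e : Sym2 (Fin n)) → u i e = 0

/-- The items of a graphical instance. -/
abbrev GraphicalInstance.Item (I : GraphicalInstance) : Type := I.G.edgeSet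

noncomputable instance (I : GraphicalInstance) : Fintype I.Item := Fintype.ofFinite _

/-- The allocations of a graphical instance: every edge is given to some agent, which need not be
one of its endpoints. -/
abbrev GraphicalInstance.Allocation (I : GraphicalInstance) : Type := I.Item → Fin I.n

/-- Envy-freeness of an allocation of a graphical instance. -/
def GraphicalInstance.IsEF (I : GraphicalInstance) (Φ : I.Allocation) : Prop :=
  IsEnvyFree I.u Φ

/-- A `{0,1}`-graphical instance: all values of single items are `0` or `1`. -/
structure BinaryGraphicalInstance extends GraphicalInstance where
  binary : ∀ (i : Fin n) (e : G.edgeSet), u i e = 0 ∨ u i e = 1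

/-! ### Encoding of instances and of solutions as words over a finite alphabet -/

/-- The alphabet of the input and output words. -/
inductive Symbol : Type
  | tick
  | sep
  | zero
  | one
  deriving DecidableEq

instance : Fintype Symbol :=
  ⟨{Symbol.tick, Symbol.sep, Symbol.zero, Symbol.one}, fun x => by cases x <;> decide⟩

/-- The unary code of a natural number, closed by a separator. -/
def encodeNat (k : ℕ) : List Symbol := List.replicate k Symbol.tick ++ [Symbol.sep]

open Classical in
/-- The code of a value that is `0` or `1`. -/
noncomputable def encodeValue (x : ℝ≥0) : Symbol := if x = 0 then Symbol.zero else Symbol.one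

namespace GraphicalInstance

variable (I : GraphicalInstance)

/-- The edge between two adjacent vertices, as an item. -/
def edge {i j : Fin I.n} (h : I.G.Adj i j) : I.Item := ⟨s(i, j), I.G.mem_edgeSet.2 h⟩

open Classical in
/-- The list of the edges, each written once as a pair `(i, j)` with `i < j`, in lexicographic
order. -/
noncomputable def edgeList : List (Fin I.n × Fin I.n) :=
  (List.finRange I.n ×ˢ List.finRange I.n).filter fun p => p.1 < p.2 ∧ I.G.Adj p.1 p.2

open Classical in
/-- The value of agent `i` for the edge `ij` (and `0` if there is no such edge). -/
noncomputable def value (i j : Fin I.n) : ℝ≥0 :=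
  if h : I.G.Adj i j then I.u i (I.edge h) else 0

/-- The record of the edge `ij` in the input: its two endpoints, then the value of `i` and the
value of `j` for it. -/
noncomputable def edgeRecord (p : Fin I.n × Fin I.n) : List Symbol :=
  encodeNat p.1 ++ encodeNat p.2 ++
    [encodeValue (I.value p.1 p.2), encodeValue (I.value p.2 p.1)]

/-- The input word: the number of agents in unary and then the list of edge records. Its length is
at least the number of agents plus the number of items, and at most polynomial in these. -/
noncomputable def encode : List Symbol := encodeNat I.n ++ I.edgeList.flatMap I.edgeRecord

open Classical in
/-- The code of an allocation: the list of the recipients of the edges, in the order of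
`edgeList`. -/
noncomputable def encodeAllocation (Φ : I.Allocation) : List Symbol :=
  I.edgeList.flatMap fun p =>
    if h : I.G.Adj p.1 p.2 then encodeNat (Φ (I.edge h)) else []

/-- The output word: `zero` for the answer that there is no solution, and `one` followed by the
code of the allocation if an allocation is returned. -/
noncomputable def encodeAnswer : Option I.Allocation → List Symbol
  | none => [Symbol.zero]
  | some Φ => Symbol.one :: I.encodeAllocation Φ

end GraphicalInstance

/-! ### The encodings lose no information -/

theorem encodeNat_append_inj {a b : ℕ} {s t : List Symbol}
    (h : encodeNat a ++ s = encodeNat b ++ t) : a = b ∧ s = t := by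
  induction a generalizing b with
  | zero =>
    cases b with
    | zero => simpa [encodeNat] using h
    | succ b => simp [encodeNat, List.replicate_succ] at h
  | succ a ih =>
    cases b with
    | zero => simp [encodeNat, List.replicate_succ] at h
    | succ b =>
      have := @ih b (by simpa [encodeNat, List.replicate_succ] using h)
      exact ⟨by omega, this.2⟩

namespace GraphicalInstance

theorem mem_edgeList (I : GraphicalInstance) (p : Fin I.n × Fin I.n) :
    p ∈ I.edgeList ↔ p.1 < p.2 ∧ I.G.Adj p.1 p.2 := by
  simp only [edgeList, List.mem_filter, decide_eq_true_eq, and_iff_right_iff_imp]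
  exact fun _ => List.mem_product.2 ⟨List.mem_finRange _, List.mem_finRange _⟩

theorem encodeAnswer_injective (I : GraphicalInstance) : Function.Injective I.encodeAnswer := by
  classical
  have key : ∀ (Φ Ψ : I.Allocation) (L : List (Fin I.n × Fin I.n)),
      (L.flatMap fun p => if h : I.G.Adj p.1 p.2 then encodeNat (Φ (I.edge h)) else []) =
      (L.flatMap fun p => if h : I.G.Adj p.1 p.2 then encodeNat (Ψ (I.edge h)) else []) →
      ∀ p ∈ L, ∀ h : I.G.Adj p.1 p.2, Φ (I.edge h) = Ψ (I.edge h) := by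
    intro Φ Ψ L
    induction L with
    | nil => simp
    | cons q L ih =>
      intro hL p hp h
      simp only [List.flatMap_cons] at hL
      by_cases hq : I.G.Adj q.1 q.2
      · rw [dif_pos hq, dif_pos hq] at hL
        obtain ⟨h1, h2⟩ := encodeNat_append_inj hL
        rcases List.mem_cons.1 hp with rfl | hp
        · exact Fin.ext h1
        · exact ih h2 p hp h
      · rw [dif_neg hq, dif_neg hq] at hL
        rcases List.mem_cons.1 hp with rfl | hp
        · exact absurd h hq
        · exact ih hL p hp h
  rintro (_ | Φ) (_ | Ψ) h
  · rfl
  · simp [encodeAnswer] at h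
  · simp [encodeAnswer] at h
  · simp only [encodeAnswer, List.cons.injEq, true_and] at h
    have hk := key Φ Ψ _ h
    congr 1
    funext ⟨e, he⟩
    induction e using Sym2.ind with
    | _ i j =>
      have ha : I.G.Adj i j := he
      rcases lt_or_gt_of_ne ha.ne with hij | hij
      · exact hk (i, j) ((I.mem_edgeList _).2 ⟨hij, ha⟩) ha
      · have := hk (j, i) ((I.mem_edgeList _).2 ⟨hij, ha.symm⟩) ha.symm
        have e1 : (⟨s(i, j), he⟩ : I.Item) = ⟨s(j, i), ha.symm⟩ := Subtype.ext Sym2.eq_swap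
        rw [e1]
        exact this

end GraphicalInstance

theorem BinaryGraphicalInstance.encode_injective :
    Function.Injective fun I : BinaryGraphicalInstance => I.encode := by
  rintro ⟨⟨n, G, u, hu⟩, bu⟩ ⟨⟨m, H, v, hv⟩, bv⟩ h
  simp only [GraphicalInstance.encode] at h
  obtain ⟨h1, h2⟩ := encodeNat_append_inj h
  change n = m at h1
  subst h1
  set I : GraphicalInstance := ⟨n, G, u, hu⟩ with hI
  set J : GraphicalInstance := ⟨n, H, v, hv⟩ with hJ
  have key : ∀ L K : List (Fin n × Fin n),
      L.flatMap I.edgeRecord = K.flatMap J.edgeRecord → L = K ∧ ∀ p ∈ L,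
        encodeValue (I.value p.1 p.2) = encodeValue (J.value p.1 p.2) ∧
        encodeValue (I.value p.2 p.1) = encodeValue (J.value p.2 p.1) := by
    intro L
    induction L with
    | nil =>
      rintro (_ | ⟨q, K⟩) hLK
      · simp
      · simp [GraphicalInstance.edgeRecord, encodeNat] at hLK
    | cons p L ih =>
      rintro (_ | ⟨q, K⟩) hLK
      · simp [GraphicalInstance.edgeRecord, encodeNat] at hLK
      · simp only [List.flatMap_cons, GraphicalInstance.edgeRecord, List.append_assoc] at hLK
        obtain ⟨a1, hLK⟩ := encodeNat_append_inj hLK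
        obtain ⟨a2, hLK⟩ := encodeNat_append_inj hLK
        have hpq : p = q := Prod.ext (Fin.ext a1) (Fin.ext a2)
        subst hpq
        simp only [List.cons_append, List.nil_append, List.cons.injEq] at hLK
        obtain ⟨b1, b2, hLK⟩ := hLK
        obtain ⟨rfl, c⟩ := ih K hLK
        refine ⟨rfl, fun r hr => ?_⟩
        rcases List.mem_cons.1 hr with rfl | hr
        · exact ⟨b1, b2⟩
        · exact c r hr
  obtain ⟨hL, hval⟩ := key _ _ h2
  have hlt : ∀ i j : Fin n, i < j → (G.Adj i j ↔ H.Adj i j) := by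
    intro i j hij
    have e1 := I.mem_edgeList (i, j)
    have e2 := J.mem_edgeList (i, j)
    rw [hL] at e1
    have := e1.symm.trans e2
    simpa [hI, hJ, hij] using this
  have hGH : G = H := by
    ext i j
    rcases lt_trichotomy i j with hij | rfl | hij
    · exact hlt i j hij
    · simp
    · rw [G.adj_comm, H.adj_comm]
      exact hlt j i hij
  subst hGH
  have hbit : ∀ x y : ℝ≥0, (x = 0 ∨ x = 1) → (y = 0 ∨ y = 1) →
      encodeValue x = encodeValue y → x = y := by
    rintro x y (rfl | rfl) (rfl | rfl) <;> simp [encodeValue]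
  have hv2 : ∀ (i j : Fin n) (a : G.Adj i j), u i ⟨s(i, j), a⟩ = v i ⟨s(i, j), a⟩ := by
    intro i j a
    have hIv : I.value i j = u i ⟨s(i, j), a⟩ := dif_pos a
    have hJv : J.value i j = v i ⟨s(i, j), a⟩ := dif_pos a
    have hIJ : encodeValue (I.value i j) = encodeValue (J.value i j) := by
      rcases lt_or_gt_of_ne a.ne with hij | hij
      · exact (hval (i, j) ((I.mem_edgeList _).2 ⟨hij, a⟩)).1
      · exact (hval (j, i) ((I.mem_edgeList _).2 ⟨hij, a.symm⟩)).2
    exact hbit _ _ (bu i _) (bv i _) (hIv ▸ hJv ▸ hIJ)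
  have huv : u = v := by
    funext k ⟨e, he⟩
    by_cases hk : k ∈ e
    · obtain ⟨l, rfl⟩ := hk
      exact hv2 k l he
    · rw [hu k ⟨e, he⟩ hk, hv k ⟨e, he⟩ hk]
  subst huv
  rfl

/-! ### Polynomial-time algorithms -/

/-- The map that sends every `{0,1}`-graphical instance `I` to the answer `f I` is computed, on the
encodings above, by a Turing machine whose number of steps is bounded by a polynomial in the length
of the input word. -/
def ComputableInPolyTime
    (f : (I : BinaryGraphicalInstance) → Option I.Allocation) : Prop :=
  Nonempty (Turing.TM2ComputableInPolyTime
    (fun I : BinaryGraphicalInstance => I.encode) (fun w : List Symbol => w)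
    (fun I : BinaryGraphicalInstance => I.encodeAnswer (f I)))

end FairDivision

/-!
Call an edge valuable for an end of it if this end has the value one for it. An envy-free allocation
exists if and only if the agents that have a valuable edge can be given pairwise different edges,
each valuable for its recipient. This is necessary, because an agent that gets no edge it values
envies the recipient of any such edge (`feasible_of_isEF`). It is sufficient: if the remaining edges
are given to their ends as well, to one that values them if possible, then the bundle of another
agent contains at most one valuable edge for `i`, namely the edge between the two agents
(`isEF_allocation`).

Such edges are found greedily. In each round, an agent in need with exactly one available valuable
edge gets this edge; if there is no such agent, any agent in need with an available valuable edge
gets one. The first choice is forced. The second one is safe, because then every agent in need has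
at least two options, and an edge that is taken away is lost for one other agent only
(`feasible_of_two`, `Feasible.assign`). So after as many rounds as there are agents, either all
agents with a valuable edge are served, or they cannot all be served (`greedy_cell`,
`sound_greedy`).

The machine keeps the list of edges, with labels, on one stack and one symbol for each agent on
another one. Every part of a round is a sweep: the list of edges is moved to a further stack, and at
each end `i` of each edge a fixed finite function rewrites a flag, the labels of the edge, and the
symbol of `i`, which is reached by popping as many symbols as the unary code of `i` says. The sweeps
are written as structured programs with a big-step semantics that counts the time; such programs are
compiled to `TM2` machines, with the same bound for the number of steps (`Exec.reachesIn`,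
`machine_outputsInTime`). The running time is cubic in the length of the input (`timeBound_le`).
-/

namespace StackProgram

open Turing Function

/-! ### Structured programs on stacks and their compilation to Turing machines -/

/-- The elementary instructions on a family of stacks, indexed by `K` and with entries in `A`, and
a register with values in `σ`. -/
inductive Op (K A σ : Type)
  | push (k : K) (f : σ → A)
  | pop (k : K) (f : σ → Option A → σ)
  | load (f : σ → σ)

/-- Structured programs: blocks of elementary instructions, sequencing, branching on the register,
and while loops. -/
inductive Prog (K A σ : Type)
  | act (l : List (Op K A σ))
  | seq (p q : Prog K A σ)
  | ite (b : σ → Bool) (p q : Prog K A σ)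
  | loop (b : σ → Bool) (p : Prog K A σ)

variable {K A σ Λ : Type}

section Semantics

variable [DecidableEq K]

/-- The effect of an elementary instruction on the register and the stacks. -/
def Op.run : Op K A σ → σ × (K → List A) → σ × (K → List A)
  | push k f, s => (s.1, update s.2 k (f s.1 :: s.2 k))
  | pop k f, s => (f s.1 (s.2 k).head?, update s.2 k (s.2 k).tail)
  | load f, s => (f s.1, s.2)

/-- The effect of a block of elementary instructions. -/
def runOps (l : List (Op K A σ)) (s : σ × (K → List A)) : σ × (K → List A) :=
  l.foldl (fun s o => o.run s) s

/-- `Exec p s t s'`: started in the state `s`, the program `p` terminates in the state `s'` after at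
most `t` units of time. A block takes one unit, and so does each evaluation of a condition. -/
inductive Exec : Prog K A σ → σ × (K → List A) → ℕ → σ × (K → List A) → Prop
  | act {l s s' t} : runOps l s = s' → 1 ≤ t → Exec (.act l) s t s'
  | seq {p q s s' s'' t₁ t₂ t} :
      Exec p s t₁ s' → Exec q s' t₂ s'' → t₁ + t₂ ≤ t → Exec (.seq p q) s t s''
  | ite_true {b p q s s' t₁ t} :
      b s.1 = true → Exec p s t₁ s' → t₁ + 1 ≤ t → Exec (.ite b p q) s t s'
  | ite_false {b p q s s' t₁ t} :
      b s.1 = false → Exec q s t₁ s' → t₁ + 1 ≤ t → Exec (.ite b p q) s t s'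
  | loop_done {b p s t} : b s.1 = false → 1 ≤ t → Exec (.loop b p) s t s
  | loop_step {b p s s' s'' t₁ t₂ t} :
      b s.1 = true → Exec p s t₁ s' → Exec (.loop b p) s' t₂ s'' → t₁ + t₂ + 1 ≤ t →
      Exec (.loop b p) s t s''

end Semantics

/-- The control points of a program; they are the labels of the compiled machine. The point `none`
of a branching or of a loop is the evaluation of its condition. -/
def Lab : Prog K A σ → Type
  | .act _ => Unit
  | .seq p q => Lab p ⊕ Lab q
  | .ite _ p q => Option (Lab p ⊕ Lab q)
  | .loop _ p => Option (Lab p)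

noncomputable instance Lab.fintype : (p : Prog K A σ) → Fintype (Lab p)
  | .act _ => inferInstanceAs (Fintype Unit)
  | .seq p q =>
    haveI := Lab.fintype p
    haveI := Lab.fintype q
    inferInstanceAs (Fintype (Lab p ⊕ Lab q))
  | .ite _ p q =>
    haveI := Lab.fintype p
    haveI := Lab.fintype q
    inferInstanceAs (Fintype (Option (Lab p ⊕ Lab q)))
  | .loop _ p =>
    haveI := Lab.fintype p
    inferInstanceAs (Fintype (Option (Lab p)))

/-- The control point at which a program starts. -/
def entry : (p : Prog K A σ) → Lab p
  | .act _ => ()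
  | .seq p _ => .inl (entry p)
  | .ite _ _ _ => none
  | .loop _ _ => none

/-- An elementary instruction, followed by the statement `q`, as a statement of a `TM2` machine. -/
def Op.stmt (q : TM2.Stmt (fun _ : K => A) Λ σ) : Op K A σ → TM2.Stmt (fun _ : K => A) Λ σ
  | push k f => .push k f q
  | pop k f => .pop k f q
  | load f => .load f q

/-- The statements at the control points of a program. The control points of the program are
embedded by `emb` into the labels of a machine, and the program exits to the label `next`. -/
def code : (p : Prog K A σ) → (emb : Lab p → Λ) → (next : Λ) → Lab p →
    TM2.Stmt (fun _ : K => A) Λ σ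
  | .act l, _, next, _ => l.foldr (fun o q => o.stmt q) (.goto fun _ => next)
  | .seq p q, emb, next, l =>
    Sum.elim (code p (fun l => emb (Sum.inl l)) (emb (Sum.inr (entry q))))
      (code q (fun l => emb (Sum.inr l)) next) l
  | .ite b p q, emb, next, l =>
    Option.elim l
      (.branch b (.goto fun _ => emb (some (Sum.inl (entry p))))
        (.goto fun _ => emb (some (Sum.inr (entry q)))))
      (Sum.elim (code p (fun l => emb (some (Sum.inl l))) next)
        (code q (fun l => emb (some (Sum.inr l))) next))
  | .loop b p, emb, next, l =>
    Option.elim l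
      (.branch b (.goto fun _ => emb (some (entry p))) (.goto fun _ => next))
      (code p (fun l => emb (some l)) (emb none))

variable [DecidableEq K]

/-- The machine `M` gets from the configuration `c` to the configuration `c'` in at most `t`
steps. -/
def ReachesIn (M : Λ → TM2.Stmt (fun _ : K => A) Λ σ) (c c' : TM2.Cfg (fun _ : K => A) Λ σ)
    (t : ℕ) : Prop :=
  Nonempty (StateTransition.EvalsToInTime (TM2.step M) c (some c') t)

theorem ReachesIn.trans {M : Λ → TM2.Stmt (fun _ : K => A) Λ σ}
    {c₁ c₂ c₃ : TM2.Cfg (fun _ : K => A) Λ σ} {t₁ t₂ t : ℕ} (h₁ : ReachesIn M c₁ c₂ t₁)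
    (h₂ : ReachesIn M c₂ c₃ t₂) (ht : t₁ + t₂ ≤ t) : ReachesIn M c₁ c₃ t := by
  obtain ⟨h₁⟩ := h₁
  obtain ⟨h₂⟩ := h₂
  have h := StateTransition.EvalsToInTime.trans _ _ _ _ _ _ h₁ h₂
  exact ⟨⟨h.toEvalsTo, h.steps_le_m.trans (by omega)⟩⟩

theorem ReachesIn.single {M : Λ → TM2.Stmt (fun _ : K => A) Λ σ}
    {c c' : TM2.Cfg (fun _ : K => A) Λ σ} {t : ℕ} (h : TM2.step M c = some c') (ht : 1 ≤ t) :
    ReachesIn M c c' t :=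
  ⟨⟨⟨1, h⟩, ht⟩⟩

theorem stepAux_foldr_stmt (l : List (Op K A σ)) (next : Λ) (s : σ × (K → List A)) :
    TM2.stepAux (l.foldr (fun o q => o.stmt q)
      (.goto fun _ => next : TM2.Stmt (fun _ : K => A) Λ σ)) s.1 s.2 =
      ⟨some next, (runOps l s).1, (runOps l s).2⟩ := by
  induction l generalizing s with
  | nil => rfl
  | cons o l ih =>
    cases o with
    | push k f => exact ih ((Op.push k f).run s)
    | pop k f => exact ih ((Op.pop k f).run s)
    | load f => exact ih ((Op.load f).run s)

/-- A machine that contains the compiled program runs it within the time of its big-step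
execution. -/
theorem Exec.reachesIn {M : Λ → TM2.Stmt (fun _ : K => A) Λ σ} {p : Prog K A σ}
    {s s' : σ × (K → List A)} {t : ℕ} (h : Exec p s t s') :
    ∀ (emb : Lab p → Λ) (next : Λ), (∀ l, M (emb l) = code p emb next l) →
      ReachesIn M ⟨some (emb (entry p)), s.1, s.2⟩ ⟨some next, s'.1, s'.2⟩ t := by
  induction h with
  | @act l s s' t hr ht =>
    intro emb next hM
    refine ReachesIn.single ?_ ht
    rw [TM2.step, hM, ← hr]
    exact congrArg some (stepAux_foldr_stmt l next s)
  | @seq p q s s' s'' t₁ t₂ t _ _ ht ih₁ ih₂ =>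
    intro emb next hM
    exact (ih₁ _ _ fun l => hM (Sum.inl l)).trans (ih₂ _ _ fun l => hM (Sum.inr l)) ht
  | @ite_true b p q s s' t₁ t hb _ ht ih =>
    intro emb next hM
    refine (ReachesIn.single (c' := ⟨some (emb (some (Sum.inl (entry p)))), s.1, s.2⟩) ?_
      le_rfl).trans (ih _ _ fun l => hM (some (Sum.inl l))) (by omega)
    rw [TM2.step, hM]
    simp [code, entry, hb]
  | @ite_false b p q s s' t₁ t hb _ ht ih =>
    intro emb next hM
    refine (ReachesIn.single (c' := ⟨some (emb (some (Sum.inr (entry q)))), s.1, s.2⟩) ?_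
      le_rfl).trans (ih _ _ fun l => hM (some (Sum.inr l))) (by omega)
    rw [TM2.step, hM]
    simp [code, entry, hb]
  | @loop_done b p s t hb ht =>
    intro emb next hM
    refine ReachesIn.single ?_ ht
    rw [TM2.step, hM]
    simp [code, entry, hb]
  | @loop_step b p s s' s'' t₁ t₂ t hb _ _ ht ih₁ ih₂ =>
    intro emb next hM
    refine (ReachesIn.single (c' := ⟨some (emb (some (entry p))), s.1, s.2⟩) ?_ le_rfl).trans
      ((ih₁ _ _ fun l => hM (some l)).trans (ih₂ emb next hM) le_rfl) (by omega)
    rw [TM2.step, hM]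
    simp [code, entry, hb]

/-- The machine that runs the program `p` and halts. -/
noncomputable def machine [Fintype K] [Fintype A] [Fintype σ] (p : Prog K A σ) (k₀ k₁ : K)
    (v₀ : σ) : FinTM2 where
  K := K
  k₀ := k₀
  k₁ := k₁
  Γ _ := A
  Λ := Option (Lab p)
  main := some (entry p)
  σ := σ
  initialState := v₀
  m l := Option.elim l .halt (code p some none)

theorem machine_outputsInTime [Fintype K] [Fintype A] [Fintype σ] {p : Prog K A σ} {k₀ k₁ : K}
    {v₀ : σ} {x y : List A} {t : ℕ}
    (h : Exec p (v₀, update (fun _ => []) k₀ x) t (v₀, update (fun _ => []) k₁ y)) :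
    Nonempty (TM2OutputsInTime (machine p k₀ k₁ v₀) x (some y) (t + 1)) := by
  have hinit : ∀ (k : K) (z : List A), (fun j => if h : j = k then z else []) =
      update (fun _ => []) k z := by
    intro k z
    funext j
    by_cases hj : j = k
    · subst hj; simp
    · simp [hj]
  have h₁ : ReachesIn (machine p k₀ k₁ v₀).m _ _ t :=
    h.reachesIn (M := (machine p k₀ k₁ v₀).m) some none fun _ => rfl
  have h₂ : ReachesIn (machine p k₀ k₁ v₀).m
      ⟨some none, v₀, update (fun _ => []) k₁ y⟩ ⟨none, v₀, update (fun _ => []) k₁ y⟩ 1 :=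
    ReachesIn.single rfl le_rfl
  have h₃ := h₁.trans h₂ le_rfl
  have e₁ : initList (machine p k₀ k₁ v₀) x =
      (⟨some (some (entry p)), v₀, update (fun _ => []) k₀ x⟩ :
        TM2.Cfg (fun _ : K => A) (Option (Lab p)) σ) := by
    rw [← hinit]; rfl
  have e₂ : haltList (machine p k₀ k₁ v₀) y =
      (⟨none, v₀, update (fun _ => []) k₁ y⟩ :
        TM2.Cfg (fun _ : K => A) (Option (Lab p)) σ) := by
    rw [← hinit]; rfl
  exact (congrArg₂ (fun a b => Nonempty (StateTransition.EvalsToInTime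
    (TM2.step (machine p k₀ k₁ v₀).m) a (some b) (t + 1))) e₁ e₂).mpr h₃

end StackProgram

namespace FairDivision

open StackProgram Function

/-! ### The abstract algorithm -/

/-- The state of the greedy algorithm on `n` agents. `lab i j` is the label of agent `i` on the
edge `ij`: as long as the edge is available, it is the value (`zero` or `one`) of `i` for the edge;
when the edge is assigned, the label of the recipient becomes `tick` and the other one `zero`. The
symbol `cell i` is `sep` if the agent `i` needs no further edge, and otherwise it records, as far
as it has been counted, the number of available edges of value one for `i`: `zero`, `one`, or `tick`
for two and more. -/
structure Status (n : ℕ) where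
  flag : Bool
  lab : Fin n → Fin n → Symbol
  cell : Fin n → Symbol

/-- What the algorithm sees of its state when it visits the end `i` of an edge `ij`: the flag, the
labels of `i` and of `j` on the edge, and the cell of `i`. -/
structure View where
  flag : Bool
  own : Symbol
  oth : Symbol
  cell : Symbol

noncomputable instance : Fintype View :=
  Fintype.ofInjective (fun r => (r.flag, r.own, r.oth, r.cell)) (by
    rintro ⟨⟩ ⟨⟩ h
    simpa using h)

section Abstract

variable {n : ℕ}

/-- The view of the state from the end `p.1` of the edge `p`. -/
def Status.view (s : Status n) (p : Fin n × Fin n) : View :=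
  ⟨s.flag, s.lab p.1 p.2, s.lab p.2 p.1, s.cell p.1⟩

/-- Writes a view back into the state. -/
def Status.write (s : Status n) (p : Fin n × Fin n) (r : View) : Status n where
  flag := r.flag
  lab i j := if (i, j) = p then r.own else if (j, i) = p then r.oth else s.lab i j
  cell := update s.cell p.1 r.cell

/-- A visit of the end `p.1` of the edge `p`, with the local transition function `h`. -/
def visit (h : View → View) (s : Status n) (p : Fin n × Fin n) : Status n :=
  s.write p (h (s.view p))

/-- The two orientations of each of the edges of a list. -/
def darts (P : List (Fin n × Fin n)) : List (Fin n × Fin n) := P.flatMap fun p => [p, p.swap]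

/-- A sweep visits both ends of all edges, one after the other. -/
def sweep (h : View → View) (P : List (Fin n × Fin n)) (s : Status n) : Status n :=
  (darts P).foldl (visit h) s

/-- The list of edges read backwards. -/
def backward (P : List (Fin n × Fin n)) : List (Fin n × Fin n) := (P.map Prod.swap).reverse

/-- An agent with an edge of value one is in need of an edge. -/
def demand (r : View) : View := if r.own = .one then { r with cell := .zero } else r

/-- The counter of an agent in need is set to zero. -/
def reset (r : View) : View := if r.cell = .sep then r else { r with cell := .zero }

/-- One more available edge, in the saturating counter of an agent in need. -/
def bump : Symbol → Symbol
  | .zero => .one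
  | .one => .tick
  | .tick => .tick
  | .sep => .sep

/-- The available edges of value one are counted. -/
def tally (r : View) : View := if r.own = .one then { r with cell := bump r.cell } else r

/-- If nothing has been assigned so far in the round, then an available edge of value one is
assigned to an agent whose counter is `c`. -/
def pick (c : Symbol) (r : View) : View :=
  if r.own = .one ∧ r.cell = c ∧ r.flag = false then ⟨true, .tick, .zero, .sep⟩ else r

/-- One round of the greedy algorithm: the available edges are counted, and then one edge is
assigned, to an agent with exactly one available edge if there is such an agent, and otherwise to
an agent with at least two. -/
def greedyRound (L : List (Fin n × Fin n)) (s : Status n) : Status n :=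
  sweep (pick .tick) L (sweep (pick .one) (backward L)
    (sweep tally L (sweep reset (backward L) { s with flag := false })))

/-- The whole run of the greedy algorithm on the list `L` of edges with the values `lab`. Every sweep
reverses the list, hence sweeps come in pairs. The second sweep with `demand` changes nothing; it
brings the list back. Each round serves one agent, so `n` rounds are enough. -/
def greedy (L : List (Fin n × Fin n)) (lab : Fin n → Fin n → Symbol) : Status n :=
  (greedyRound L)^[n] (sweep demand L (sweep demand (backward L) ⟨false, lab, fun _ => .sep⟩))

/-- The recipient of an edge at the end of the run. The label `zero` means that the edge has been
assigned to the other end, or that it has no value for this one; thus an edge that has not been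
assigned goes to an end that has the value one for it, if there is such an end. -/
def recipient (lab : Fin n → Fin n → Symbol) (p : Fin n × Fin n) : Fin n :=
  if lab p.1 p.2 = .zero then p.2 else p.1

theorem backward_cons (p : Fin n × Fin n) (P : List (Fin n × Fin n)) :
    backward (p :: P) = backward P ++ [p.swap] := by
  simp [backward]

theorem backward_backward (P : List (Fin n × Fin n)) : backward (backward P) = P := by
  simp [backward, ← List.map_reverse]

theorem length_backward (P : List (Fin n × Fin n)) : (backward P).length = P.length := by
  simp [backward]

theorem mem_darts {P : List (Fin n × Fin n)} {q : Fin n × Fin n} :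
    q ∈ darts P ↔ q ∈ P ∨ q.swap ∈ P := by
  simp only [darts, List.mem_flatMap, List.mem_cons, List.not_mem_nil, or_false]
  constructor
  · rintro ⟨p, hp, rfl | rfl⟩ <;> simp [hp]
  · rintro (h | h)
    · exact ⟨q, h, .inl rfl⟩
    · exact ⟨q.swap, h, .inr (by simp)⟩

theorem darts_backward (P : List (Fin n × Fin n)) : darts (backward P) = (darts P).reverse := by
  induction P with
  | nil => rfl
  | cons p P ih =>
    rw [backward_cons, darts, List.flatMap_append]
    change darts (backward P) ++ _ = _
    rw [ih]
    simp [darts]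

theorem foldl_visit_lab (h : View → View) (D : List (Fin n × Fin n)) (s : Status n) {i j : Fin n}
    (h₁ : (i, j) ∉ D) (h₂ : (j, i) ∉ D) : (D.foldl (visit h) s).lab i j = s.lab i j := by
  induction D generalizing s with
  | nil => rfl
  | cons p D ih =>
    simp only [List.mem_cons, not_or] at h₁ h₂
    rw [List.foldl_cons, ih _ h₁.2 h₂.2]
    simp [visit, Status.write, h₁.1, h₂.1]

end Abstract

/-! ### The stacks of the machine -/

/-- The stacks of the machine: the list of edges is moved to and fro between two of them; the others
hold the cells of the agents, the cells above the one that is visited, the number of rounds to come,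
and the output. -/
inductive Stack : Type
  | side (d : Bool)
  | cells
  | temp
  | count
  | out
  deriving DecidableEq

instance : Fintype Stack :=
  ⟨{.side true, .side false, .cells, .temp, .count, .out}, fun x => by
    cases x with
    | side d => cases d <;> decide
    | _ => decide⟩

/-- The register of the machine: the symbol that was popped last, and the current view. -/
abbrev Register : Type := Option Symbol × View

/-- A family of stacks, given by its members; the stack `side d` comes first. -/
def stk (d : Bool) (x y c t k o : List Symbol) : Stack → List Symbol
  | .side b => if b = d then x else y
  | .cells => c
  | .temp => t
  | .count => k
  | .out => o

section Stacks

variable (d b : Bool) (x y c t k o z : List Symbol)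

@[simp] theorem stk_side : stk d x y c t k o (.side b) = if b = d then x else y := rfl
@[simp] theorem stk_cells : stk d x y c t k o .cells = c := rfl
@[simp] theorem stk_temp : stk d x y c t k o .temp = t := rfl
@[simp] theorem stk_count : stk d x y c t k o .count = k := rfl
@[simp] theorem stk_out : stk d x y c t k o .out = o := rfl

@[simp] theorem update_stk_side : update (stk d x y c t k o) (.side b) z =
    if b = d then stk d z y c t k o else stk d x z c t k o := by
  funext s
  cases s with
  | side e => cases d <;> cases b <;> cases e <;> simp [stk, update]
  | _ => cases d <;> cases b <;> simp [stk, update]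

@[simp] theorem update_stk_cells :
    update (stk d x y c t k o) .cells z = stk d x y z t k o := by
  funext s
  cases s <;> simp [stk, update]

@[simp] theorem update_stk_temp :
    update (stk d x y c t k o) .temp z = stk d x y c z k o := by
  funext s
  cases s <;> simp [stk, update]

@[simp] theorem update_stk_count :
    update (stk d x y c t k o) .count z = stk d x y c t z o := by
  funext s
  cases s <;> simp [stk, update]

@[simp] theorem update_stk_out :
    update (stk d x y c t k o) .out z = stk d x y c t k z := by
  funext s
  cases s <;> simp [stk, update]

theorem stk_not : stk (!d) x y c t k o = stk d y x c t k o := by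
  funext s
  cases s <;> cases d <;> simp [stk] <;> rename_i b <;> cases b <;> simp

end Stacks

/-! ### The programs -/

/-- Programs on the stacks of the machine. -/
abbrev Program : Type := Prog Stack Symbol Register

/-- Pops a stack into the first component of the register. -/
def popTop (k : Stack) : Op Stack Symbol Register := .pop k fun v a => (a, v.2)

/-- Pushes the first component of the register. -/
def pushTop (k : Stack) : Op Stack Symbol Register := .push k fun v => v.1.getD .tick

/-- Pushes a fixed symbol. -/
def put (k : Stack) (a : Symbol) : Op Stack Symbol Register := .push k fun _ => a

/-- Changes the view in the register. -/
def change (h : View → View) : Op Stack Symbol Register := .load fun v => (v.1, h v.2)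

/-- The other end of the edge. -/
def View.turn (r : View) : View := { r with own := r.oth, oth := r.own }

/-- Repeats a block as long as the symbol in the register is `tick`. -/
abbrev whileTick (l : List (Op Stack Symbol Register)) : Program :=
  .loop (fun v => decide (v.1 = some .tick)) (.act l)

/-- Repeats a program as long as there is a symbol in the register. -/
abbrev whileSome (p : Program) : Program := .loop (fun v => v.1.isSome) p

/-- Visits the end of an edge: the unary code of the end is moved from one side to the other, and
as many cells are removed, so that the cell of the end lies on the top. -/
def visitProg (d : Bool) (h : View → View) : Program :=
  .seq (.act [put (.side !d) .sep, popTop (.side d)]) <|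
  .seq (whileTick [put (.side !d) .tick, popTop .cells, pushTop .temp, popTop (.side d)]) <|
  .seq (.act [.pop .cells fun v a => (v.1, { v.2 with cell := a.getD .tick }), change h,
    .push .cells fun v => v.2.cell, change View.turn, popTop .temp]) <|
  whileSome (.act [pushTop .cells, popTop .temp])

/-- Moves the list of edges from the side `d` to the other one, and visits both ends of each edge.
In this way the list is reversed, and the two ends of each edge are interchanged. Each visit turns
the view to the other end, so that after two of them the labels are in their original places. -/
def sweepProg (d : Bool) (h : View → View) : Program :=
  .seq (.act [popTop (.side d)]) <| whileSome <|
  .seq (.act [.load fun v => (v.1, { v.2 with own := v.1.getD .tick }),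
    .pop (.side d) fun v a => (v.1, { v.2 with oth := a.getD .tick })]) <|
  .seq (visitProg d h) <| .seq (visitProg d h) <|
  .act [.push (.side !d) fun v => v.2.own, .push (.side !d) fun v => v.2.oth, popTop (.side d)]

/-- Reads the number of agents, and prepares their cells and the counter of rounds. -/
def readAgents : Program :=
  .seq (.act [popTop (.side true)]) <|
  whileTick [put .cells .sep, put .count .tick, popTop (.side true)]

/-- Reads the list of edges, and moves it from one side to the other. -/
def readEdges : Program :=
  .seq (.act [popTop (.side true)]) <| whileSome <|
  .seq (.act [put (.side false) .sep]) <|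
  .seq (whileTick [put (.side false) .tick, popTop (.side true)]) <|
  .seq (.act [put (.side false) .sep, popTop (.side true)]) <|
  .seq (whileTick [put (.side false) .tick, popTop (.side true)]) <|
  .act [popTop (.side true), pushTop (.side false), popTop (.side true), pushTop (.side false),
    popTop (.side true)]

/-- A round of the greedy algorithm. -/
def roundProg : Program :=
  .seq (.act [change fun r => { r with flag := false }]) <|
  .seq (sweepProg false reset) <| .seq (sweepProg true tally) <|
  .seq (sweepProg false (pick .one)) <| sweepProg true (pick .tick)

/-- As many rounds as there are symbols on the stack `count`. -/
def roundsProg : Program :=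
  .seq (.act [popTop .count]) <| whileSome <| .seq roundProg <| .act [popTop .count]

/-- Empties the stack of cells, and raises the flag if an agent is still in need. -/
def checkProg : Program :=
  .seq (.act [change fun r => { r with flag := false }, popTop .cells]) <| whileSome <|
  .act [.load fun v => (v.1, { v.2 with flag := v.2.flag || decide (v.1 ≠ some .sep) }),
    popTop .cells]

/-- Writes the list of recipients to the output. -/
def writeProg : Program :=
  .seq (.act [popTop (.side false)]) <| whileSome <|
  .seq (.act [.pop (.side false) fun v a => (v.1, { v.2 with oth := a.getD .tick }),
    put .out .sep, popTop (.side false)]) <|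
  .seq (.ite (fun v => decide (v.2.oth = .zero))
    (.seq (whileTick [put .out .tick, popTop (.side false)]) <|
      .seq (.act [popTop (.side false)]) <| whileTick [popTop (.side false)])
    (.seq (whileTick [popTop (.side false)]) <|
      .seq (.act [popTop (.side false)]) <| whileTick [put .out .tick, popTop (.side false)])) <|
  .act [popTop (.side false)]

/-- Empties the list of edges. -/
def clearProg : Program :=
  .seq (.act [popTop (.side false)]) <| whileSome <| .act [popTop (.side false)]

/-- The initial and final value of the register. -/
def register₀ : Register := (none, ⟨false, .tick, .tick, .tick⟩)

/-- The program that decides whether there is an envy-free allocation, and finds one. -/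
def mainProg : Program :=
  .seq readAgents <| .seq readEdges <|
  .seq (sweepProg false demand) <| .seq (sweepProg true demand) <| .seq roundsProg <|
  .seq checkProg <|
  .seq (.ite (fun v => v.2.flag) (.seq clearProg (.act [put .out .zero]))
    (.seq writeProg (.act [put .out .one]))) <|
  .act [.load fun _ => register₀]

/-! ### Execution of the programs -/

theorem encodeNat_succ_append (u : ℕ) (x : List Symbol) :
    encodeNat (u + 1) ++ x = .tick :: (encodeNat u ++ x) := by
  simp [encodeNat, List.replicate_succ]

theorem replicate_append_cons (u : ℕ) (a : Symbol) (y : List Symbol) :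
    List.replicate u a ++ a :: y = List.replicate (u + 1) a ++ y := by
  rw [List.replicate_succ', List.append_assoc, List.singleton_append]

section Loops

variable {d : Bool} {y w t k o : List Symbol} {r : View}

/-- The loop that moves the unary code of `u` to the other side and takes `u` cells away. The stack
`z` lacks its first symbol, which has been popped into the register before the condition is
tested; the other loops are described in the same way. -/
theorem exec_walk (u : ℕ) {x z : List Symbol} (hx : z = encodeNat u ++ x) (hu : u ≤ w.length) :
    Exec (whileTick [put (.side !d) .tick, popTop .cells, pushTop .temp, popTop (.side d)])
      ((z.head?, r), stk d z.tail y w t k o) (2 * u + 1)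
      ((some .sep, r),
        stk d x (List.replicate u .tick ++ y) (w.drop u) ((w.take u).reverse ++ t) k o) := by
  subst hx
  induction u generalizing y w t with
  | zero => exact .loop_done (by simp [encodeNat]) le_rfl
  | succ u ih =>
    obtain _ | ⟨a, w⟩ := w
    · simp at hu
    refine .loop_step (t₁ := 1) (t₂ := 2 * u + 1) (by simp [encodeNat_succ_append])
      (.act rfl le_rfl) ?_ (by omega)
    have h := ih (y := .tick :: y) (w := w) (t := a :: t) (by simpa using hu)
    simpa [runOps, Op.run, put, popTop, pushTop, encodeNat_succ_append, replicate_append_cons]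
      using h

theorem exec_restore {x : List Symbol} :
    Exec (whileSome (.act [pushTop .cells, popTop .temp]))
      ((t.head?, r), stk d x y w t.tail k o) (2 * t.length + 1)
      ((none, r), stk d x y (t.reverse ++ w) [] k o) := by
  induction t generalizing w with
  | nil => exact .loop_done rfl le_rfl
  | cons a t ih =>
    refine .loop_step (t₁ := 1) (t₂ := 2 * t.length + 1) rfl (.act rfl le_rfl) ?_ (by simp; omega)
    simpa [runOps, Op.run, popTop, pushTop] using ih (w := a :: w)

theorem exec_visitProg (h : View → View) {x : List Symbol} {a : Option Symbol} (u : ℕ)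
    (hu : u < w.length) :
    Exec (visitProg d h) ((a, r), stk d (encodeNat u ++ x) y w [] k o) (4 * u + 4)
      ((none, (h { r with cell := w[u] }).turn),
        stk d x (encodeNat u ++ y) (w.set u (h { r with cell := w[u] }).cell) [] k o) := by
  have hw := exec_walk (d := d) (y := .sep :: y) (t := []) (k := k) (o := o) (r := r) u
    (x := x) rfl hu.le
  have hr := exec_restore (d := d) (x := x) (y := encodeNat u ++ y) (k := k) (o := o)
    (w := (h { r with cell := w[u] }).cell :: w.drop (u + 1)) (t := (w.take u).reverse)
    (r := (h { r with cell := w[u] }).turn)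
  rw [List.reverse_reverse, ← List.set_eq_take_cons_drop _ hu] at hr
  refine .seq (.act (t := 1) ?_ le_rfl) (.seq hw (.seq (.act (t := 1) ?_ le_rfl) hr le_rfl)
    le_rfl) ?_
  · simp [runOps, Op.run, put, popTop]
  · rw [List.drop_eq_getElem_cons hu]
    simp [runOps, Op.run, popTop, change, encodeNat, View.turn, List.getElem?_eq_getElem hu]
  · simp
    omega

/-- The record of the edge `p` on the stacks of the machine: its two labels and its two ends. The
labels come first, since they have to be in the register when the ends are visited. When the record
is moved to the other side, it becomes the record of `p.swap`. -/
def record {n : ℕ} (lab : Fin n → Fin n → Symbol) (p : Fin n × Fin n) : List Symbol :=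
  lab p.1 p.2 :: lab p.2 p.1 :: (encodeNat p.1 ++ encodeNat p.2)

theorem ofFn_update {n : ℕ} (c : Fin n → Symbol) (i : Fin n) (a : Symbol) :
    List.ofFn (update c i a) = (List.ofFn c).set i a := by
  apply List.ext_getElem
  · simp
  · intro m h₁ h₂
    simp only [List.getElem_ofFn, List.getElem_set, update_apply, Fin.ext_iff]
    by_cases hm : m = i <;> simp [hm, eq_comm]

/-- The loop of a sweep. As the darts of `P` are distinct, a visit does not change the labels of the
edges that are still to come, nor of those that have been moved to the other side already. The stack
`z` is what the loop finds; its first symbol is in the register when the condition is tested. -/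
theorem exec_sweep_loop (h : View → View) {n : ℕ} (P : List (Fin n × Fin n)) (s : Status n)
    (hP : (darts P).Nodup) {z : List Symbol} (hz : z = P.flatMap (record s.lab))
    (hr : r.flag = s.flag) :
    ∃ r' : View, r'.flag = (sweep h P s).flag ∧
    Exec (whileSome <|
      .seq (.act [.load fun v => (v.1, { v.2 with own := v.1.getD .tick }),
        .pop (.side d) fun v a => (v.1, { v.2 with oth := a.getD .tick })]) <|
      .seq (visitProg d h) <| .seq (visitProg d h) <|
      .act [.push (.side !d) fun v => v.2.own, .push (.side !d) fun v => v.2.oth,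
        popTop (.side d)])
      ((z.head?, r), stk d z.tail y (List.ofFn s.cell) [] k o) (P.length * (8 * n + 11) + 1)
      ((none, r'), stk d [] ((backward P).flatMap (record (sweep h P s).lab) ++ y)
        (List.ofFn (sweep h P s).cell) [] k o) := by
  induction P generalizing s r y z with
  | nil =>
    subst hz
    exact ⟨r, hr, .loop_done rfl (by simp)⟩
  | cons p P ih =>
    obtain ⟨i, j⟩ := p
    have hD : darts ((i, j) :: P) = (i, j) :: (j, i) :: darts P := rfl
    rw [hD, List.nodup_cons, List.nodup_cons] at hP
    obtain ⟨hi, hj, hP⟩ := hP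
    simp only [List.mem_cons, not_or] at hi
    have hij : i ≠ j := fun e => hi.1 (by rw [e])
    -- `s₁` and `s₂` are the states after the visits of the two ends of the first edge
    set s₁ := visit h s (i, j) with hs₁
    set s₂ := visit h s₁ (j, i) with hs₂
    have hsw : sweep h ((i, j) :: P) s = sweep h P s₂ := rfl
    have hlab : ∀ p ∈ P, record s₂.lab p = record s.lab p := by
      rintro ⟨a, b⟩ hp
      have h₁ : (a, b) ≠ (i, j) := fun e => hi.2 (e ▸ mem_darts.2 (.inl hp))
      have h₂ : (a, b) ≠ (j, i) := fun e => hj (e ▸ mem_darts.2 (.inl hp))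
      have h₃ : (b, a) ≠ (i, j) := fun e => h₂ (by simp_all)
      have h₄ : (b, a) ≠ (j, i) := fun e => h₁ (by simp_all)
      simp [record, hs₂, hs₁, visit, Status.write, h₁, h₂, h₃, h₄, -Prod.mk.injEq]
    have hlab' : record (sweep h P s₂).lab (j, i) = record s₂.lab (j, i) := by
      have e₁ := foldl_visit_lab h (darts P) s₂ hi.2 hj
      have e₂ := foldl_visit_lab h (darts P) s₂ hj hi.2
      rw [← sweep] at e₁ e₂
      simp [record, e₁, e₂]
    set r₁ : View := ⟨r.flag, s.lab i j, s.lab j i, r.cell⟩ with hr₁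
    have v₁ : h { r₁ with cell := (List.ofFn s.cell)[(i : ℕ)]'(by simp) } = h (s.view (i, j)) := by
      simp [hr₁, Status.view, hr]
    have v₂ : h { (h (s.view (i, j))).turn with
        cell := (List.ofFn s₁.cell)[(j : ℕ)]'(by simp) } = h (s₁.view (j, i)) := by
      have hji : j ≠ i := hij.symm
      simp [Status.view, hs₁, visit, Status.write, View.turn, hij, hji]
    have e₁ := exec_visitProg (d := d) (y := y) (k := k) (o := o) (r := r₁)
      (w := List.ofFn s.cell) h (x := encodeNat j ++ P.flatMap (record s.lab))
      (a := some (s.lab i j)) i (by simp)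
    have e₂ := exec_visitProg (d := d) (y := encodeNat i ++ y) (k := k) (o := o)
      (r := (h (s.view (i, j))).turn)
      (w := List.ofFn s₁.cell) h (x := P.flatMap (record s.lab)) (a := none) j (by simp)
    rw [v₁, ← ofFn_update, show update s.cell i (h (s.view (i, j))).cell = s₁.cell from rfl] at e₁
    rw [v₂, ← ofFn_update, show update s₁.cell j (h (s₁.view (j, i))).cell = s₂.cell from rfl] at e₂
    obtain ⟨r', hr', e₃⟩ := ih s₂ hP (r := (h (s₁.view (j, i))).turn)
      (y := record s₂.lab (j, i) ++ y) rfl rfl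
    refine ⟨r', by rw [hsw]; exact hr', ?_⟩
    rw [hsw, backward_cons, List.flatMap_append, List.append_assoc]
    simp only [List.flatMap_cons, List.flatMap_nil, List.append_nil, Prod.swap_prod_mk]
    rw [hlab']
    refine .loop_step (t₁ := 8 * n + 10) (t₂ := P.length * (8 * n + 11) + 1) ?_
      (.seq (t₁ := 1) (s' := ((some (s.lab i j), r₁), stk d (encodeNat i ++
        (encodeNat j ++ P.flatMap (record s.lab))) y (List.ofFn s.cell) [] k o)) (.act ?_ le_rfl)
        (.seq e₁ (.seq e₂ (.act (t := 1) rfl le_rfl) le_rfl) le_rfl) ?_) ?_ ?_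
    · subst hz
      simp [record]
    · subst hz
      simp [runOps, Op.run, record, hr₁]
    · omega
    · have e₀ : P.flatMap (record s₂.lab) = P.flatMap (record s.lab) :=
        List.flatMap_congr hlab
      have hji : j ≠ i := hij.symm
      rw [e₀] at e₃
      have a₁ : s₂.lab j i = (h (s₁.view (j, i))).own := by simp [hs₂, visit, Status.write]
      have a₂ : s₂.lab i j = (h (s₁.view (j, i))).oth := by simp [hs₂, visit, Status.write, hij]
      simpa [runOps, Op.run, View.turn, popTop, record, a₁, a₂] using e₃
    · simp
      ring_nf
      omega

end Loops

theorem exec_sweepProg (h : View → View) {d : Bool} {n : ℕ} {P : List (Fin n × Fin n)}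
    (hP : (darts P).Nodup) (s : Status n) {a : Option Symbol} {r : View} {k : List Symbol}
    (hr : r.flag = s.flag) :
    ∃ (a' : Option Symbol) (r' : View), r'.flag = (sweep h P s).flag ∧
    Exec (sweepProg d h)
      ((a, r), stk d (P.flatMap (record s.lab)) [] (List.ofFn s.cell) [] k [])
      (P.length * (8 * n + 11) + 2)
      ((a', r'), stk (!d) ((backward P).flatMap (record (sweep h P s).lab)) []
        (List.ofFn (sweep h P s).cell) [] k []) := by
  obtain ⟨r', hr', e⟩ := exec_sweep_loop (d := d) (y := []) (k := k) (o := []) h P s hP rfl hr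
  rw [List.append_nil, ← stk_not d ((backward P).flatMap _)] at e
  exact ⟨none, r', hr', .seq (t₁ := 1) (.act (by simp [runOps, Op.run, popTop]) le_rfl) e
    (by omega)⟩

/-- The configuration `c` of the machine, between two sweeps, represents the state `s` of the
algorithm: the records of the list `P` of edges are on the side `d`, the cells of all agents are on
their stack, and `k` is on the stack `count`. Only the flag of the register matters. -/
def Holds {n : ℕ} (d : Bool) (P : List (Fin n × Fin n)) (s : Status n) (k : List Symbol)
    (c : Register × (Stack → List Symbol)) : Prop :=
  ∃ (a : Option Symbol) (r : View), r.flag = s.flag ∧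
    c = ((a, r), stk d (P.flatMap (record s.lab)) [] (List.ofFn s.cell) [] k [])

theorem Holds.sweep (h : View → View) {d : Bool} {n : ℕ} {P : List (Fin n × Fin n)} {s : Status n}
    {k : List Symbol} {c : Register × (Stack → List Symbol)} (hP : (darts P).Nodup)
    (hc : Holds d P s k c) :
    ∃ c', Holds (!d) (backward P) (sweep h P s) k c' ∧
      Exec (sweepProg d h) c (P.length * (8 * n + 11) + 2) c' := by
  obtain ⟨a, r, hr, rfl⟩ := hc
  obtain ⟨a', r', hr', e⟩ := exec_sweepProg h (d := d) hP s (a := a) (k := k) hr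
  exact ⟨_, ⟨a', r', hr', rfl⟩, e⟩

theorem nodup_darts_backward {n : ℕ} {P : List (Fin n × Fin n)} (hP : (darts P).Nodup) :
    (darts (backward P)).Nodup := by
  rw [darts_backward]
  exact List.nodup_reverse.2 hP

theorem Holds.round {n : ℕ} {L : List (Fin n × Fin n)} {s : Status n}
    {k : List Symbol} {c : Register × (Stack → List Symbol)} (hL : (darts L).Nodup)
    (hc : Holds false (backward L) s k c) :
    ∃ c', Holds false (backward L) (greedyRound L s) k c' ∧
      Exec roundProg c (4 * (L.length * (8 * n + 11)) + 9) c' := by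
  have hb := nodup_darts_backward hL
  obtain ⟨a, r, hr, rfl⟩ := hc
  have h₀ : Holds false (backward L) { s with flag := false } k
    ((a, { r with flag := false }), stk false ((backward L).flatMap (record s.lab)) []
      (List.ofFn s.cell) [] k []) := ⟨a, _, rfl, rfl⟩
  obtain ⟨c₁, h₁, e₁⟩ := h₀.sweep reset hb
  rw [backward_backward] at h₁
  obtain ⟨c₂, h₂, e₂⟩ := h₁.sweep tally hL
  obtain ⟨c₃, h₃, e₃⟩ := h₂.sweep (pick .one) hb
  rw [backward_backward] at h₃
  obtain ⟨c₄, h₄, e₄⟩ := h₃.sweep (pick .tick) hL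
  refine ⟨c₄, h₄, .seq (.act (t := 1) ?_ le_rfl) (.seq e₁ (.seq e₂ (.seq e₃ e₄ le_rfl) le_rfl)
    le_rfl) ?_⟩
  · simp [runOps, Op.run, change]
  · rw [length_backward]
    omega

theorem exec_rounds {n : ℕ} {L : List (Fin n × Fin n)} (hL : (darts L).Nodup) (m : ℕ)
    {s : Status n} {c : Register × (Stack → List Symbol)}
    (hc : Holds false (backward L) s (List.replicate m .tick) c) :
    ∃ c', Holds false (backward L) ((greedyRound L)^[m] s) [] c' ∧
      Exec roundsProg c (m * (4 * (L.length * (8 * n + 11)) + 11) + 2) c' := by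
  suffices h : ∀ (m : ℕ) (s : Status n) (c : Register × (Stack → List Symbol)),
      Holds false (backward L) s (List.replicate m .tick) c →
      ∃ c', Holds false (backward L) ((greedyRound L)^[m] s) [] c' ∧
        Exec (whileSome <| .seq roundProg <| .act [popTop .count]) (runOps [popTop .count] c)
          (m * (4 * (L.length * (8 * n + 11)) + 11) + 1) c' by
    obtain ⟨c', hc', e⟩ := h m s c hc
    exact ⟨c', hc', .seq (.act (t := 1) rfl le_rfl) e (by omega)⟩
  intro m
  induction m with
  | zero =>
    rintro s c ⟨a, r, hr, rfl⟩
    refine ⟨_, ⟨none, r, hr, rfl⟩, ?_⟩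
    have e : runOps [popTop .count] ((a, r), stk false ((backward L).flatMap (record s.lab)) []
        (List.ofFn s.cell) [] [] []) = ((none, r), stk false
          ((backward L).flatMap (record s.lab)) [] (List.ofFn s.cell) [] [] []) := by
      simp [runOps, Op.run, popTop]
    simp only [List.replicate_zero]
    rw [e]
    exact .loop_done rfl (by omega)
  | succ m ih =>
    rintro s c ⟨a, r, hr, rfl⟩
    have h₀ : Holds false (backward L) s (List.replicate m .tick) (runOps [popTop .count]
        ((a, r), stk false ((backward L).flatMap (record s.lab)) []
        (List.ofFn s.cell) [] (List.replicate (m + 1) .tick) [])) :=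
      ⟨some .tick, r, hr, by simp [runOps, Op.run, popTop, List.replicate_succ]⟩
    obtain ⟨c₁, h₁, e₁⟩ := h₀.round hL
    obtain ⟨c₂, h₂, e₂⟩ := ih _ _ h₁
    refine ⟨c₂, h₂, .loop_step ?_ (.seq e₁ (.act (t := 1) rfl le_rfl) le_rfl) e₂ ?_⟩
    · simp [runOps, Op.run, popTop, List.replicate_succ]
    · ring_nf
      omega

section Reading

variable {y w k o x : List Symbol} {r : View}

theorem exec_readAgents (m : ℕ) {a : Option Symbol} :
    Exec readAgents ((a, r), stk true (encodeNat m ++ x) y [] [] [] o) (2 * m + 2)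
      ((some .sep, r),
        stk true x y (List.replicate m .sep) [] (List.replicate m .tick) o) := by
  suffices h : ∀ (m : ℕ) (w k z : List Symbol), z = encodeNat m ++ x →
      Exec (whileTick [put .cells .sep, put .count .tick, popTop (.side true)])
      ((z.head?, r), stk true z.tail y w [] k o) (2 * m + 1)
      ((some .sep, r), stk true x y (List.replicate m .sep ++ w) []
        (List.replicate m .tick ++ k) o) by
    have := h m [] [] _ rfl
    simp only [List.append_nil] at this
    exact .seq (.act (t := 1) (by simp [runOps, Op.run, popTop]) le_rfl) this (by omega)
  rintro m w k z rfl
  induction m generalizing w k with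
  | zero => exact .loop_done (by simp [encodeNat]) le_rfl
  | succ m ih =>
    refine .loop_step (t₁ := 1) (t₂ := 2 * m + 1) (by simp [encodeNat_succ_append])
      (.act rfl le_rfl) ?_ (by omega)
    simpa [runOps, Op.run, put, popTop, encodeNat_succ_append, replicate_append_cons]
      using ih (.sep :: w) (.tick :: k)

theorem exec_copy_side (u : ℕ) {z : List Symbol} (hz : z = encodeNat u ++ x) :
    Exec (whileTick [put (.side false) .tick, popTop (.side true)])
      ((z.head?, r), stk true z.tail y w [] k o) (2 * u + 1)
      ((some .sep, r), stk true x (List.replicate u .tick ++ y) w [] k o) := by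
  subst hz
  induction u generalizing y with
  | zero => exact .loop_done (by simp [encodeNat]) le_rfl
  | succ u ih =>
    refine .loop_step (t₁ := 1) (t₂ := 2 * u + 1) (by simp [encodeNat_succ_append])
      (.act rfl le_rfl) ?_ (by omega)
    simpa [runOps, Op.run, put, popTop, encodeNat_succ_append, replicate_append_cons]
      using ih (y := .tick :: y)

theorem exec_copy_out (u : ℕ) {z : List Symbol} (hz : z = encodeNat u ++ x) :
    Exec (whileTick [put .out .tick, popTop (.side false)])
      ((z.head?, r), stk false z.tail y w [] k o) (2 * u + 1)
      ((some .sep, r), stk false x y w [] k (List.replicate u .tick ++ o)) := by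
  subst hz
  induction u generalizing o with
  | zero => exact .loop_done (by simp [encodeNat]) le_rfl
  | succ u ih =>
    refine .loop_step (t₁ := 1) (t₂ := 2 * u + 1) (by simp [encodeNat_succ_append])
      (.act rfl le_rfl) ?_ (by omega)
    simpa [runOps, Op.run, put, popTop, encodeNat_succ_append, replicate_append_cons]
      using ih (o := .tick :: o)

theorem exec_skip (u : ℕ) {z : List Symbol} (hz : z = encodeNat u ++ x) :
    Exec (whileTick [popTop (.side false)])
      ((z.head?, r), stk false z.tail y w [] k o) (2 * u + 1)
      ((some .sep, r), stk false x y w [] k o) := by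
  subst hz
  induction u with
  | zero => exact .loop_done (by simp [encodeNat]) le_rfl
  | succ u ih =>
    refine .loop_step (t₁ := 1) (t₂ := 2 * u + 1) (by simp [encodeNat_succ_append])
      (.act rfl le_rfl) ?_ (by omega)
    simpa [runOps, Op.run, popTop, encodeNat_succ_append] using ih

/-- The record of an edge in the input word, where the labels come last. -/
def inputRecord {n : ℕ} (lab : Fin n → Fin n → Symbol) (p : Fin n × Fin n) : List Symbol :=
  encodeNat p.1 ++ encodeNat p.2 ++ [lab p.1 p.2, lab p.2 p.1]

theorem exec_readEdges {n : ℕ} (lab : Fin n → Fin n → Symbol) (L : List (Fin n × Fin n))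
    {a : Option Symbol} :
    Exec readEdges ((a, r), stk true (L.flatMap (inputRecord lab)) [] w [] k o)
      (L.length * (4 * n + 6) + 2)
      ((none, r), stk true [] ((backward L).flatMap (record lab)) w [] k o) := by
  suffices h : ∀ (L : List (Fin n × Fin n)) (y z : List Symbol),
      z = L.flatMap (inputRecord lab) →
      Exec (whileSome <|
        .seq (.act [put (.side false) .sep]) <|
        .seq (whileTick [put (.side false) .tick, popTop (.side true)]) <|
        .seq (.act [put (.side false) .sep, popTop (.side true)]) <|
        .seq (whileTick [put (.side false) .tick, popTop (.side true)]) <|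
        .act [popTop (.side true), pushTop (.side false), popTop (.side true),
          pushTop (.side false), popTop (.side true)])
      ((z.head?, r), stk true z.tail y w [] k o) (L.length * (4 * n + 6) + 1)
      ((none, r), stk true [] ((backward L).flatMap (record lab) ++ y) w [] k o) by
    have := h L [] _ rfl
    simp only [List.append_nil] at this
    exact .seq (.act (t := 1) (by simp [runOps, Op.run, popTop]) le_rfl) this (by omega)
  intro L
  induction L with
  | nil =>
    rintro y z rfl
    exact .loop_done rfl (by simp)
  | cons p L ih =>
    rintro y z rfl
    obtain ⟨i, j⟩ := p
    rw [backward_cons, List.flatMap_append, List.append_assoc, List.flatMap_cons]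
    have hi := i.2
    have hj := j.2
    have e₁ := exec_copy_side (y := .sep :: y) (w := w) (k := k) (o := o) (r := r)
      (x := encodeNat j ++ (lab i j :: lab j i :: L.flatMap (inputRecord lab))) i rfl
    have e₂ := exec_copy_side (y := .sep :: (List.replicate i .tick ++ .sep :: y)) (w := w)
      (k := k) (o := o) (r := r) (x := lab i j :: lab j i :: L.flatMap (inputRecord lab)) j rfl
    have e₃ := ih (record lab (j, i) ++ y) _ rfl
    refine .loop_step (t₁ := 4 * n + 5) (t₂ := L.length * (4 * n + 6) + 1) ?_
      (.seq (.act (t := 1) ?_ le_rfl) (.seq e₁ (.seq (.act (t := 1) ?_ le_rfl)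
        (.seq e₂ (.act (t := 1) rfl le_rfl) le_rfl) le_rfl) le_rfl) ?_) ?_ ?_
    · simp [inputRecord, encodeNat]
    · simp [runOps, Op.run, put, inputRecord]
    · simp [runOps, Op.run, put, popTop]
    · omega
    · simpa [runOps, Op.run, popTop, pushTop, record, encodeNat] using e₃
    · simp
      ring_nf
      omega

theorem exec_checkProg {a : Option Symbol} :
    ∃ r' : View, r'.flag = w.any (fun c => decide (c ≠ .sep)) ∧
      Exec checkProg ((a, r), stk false x y w [] k o) (2 * w.length + 2)
        ((none, r'), stk false x y [] [] k o) := by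
  suffices h : ∀ (w : List Symbol) (r : View), ∃ r' : View,
      r'.flag = (r.flag || w.any (fun c => decide (c ≠ .sep))) ∧
      Exec (whileSome <|
      .act [.load fun v => (v.1, { v.2 with flag := v.2.flag || decide (v.1 ≠ some .sep) }),
        popTop .cells]) ((w.head?, r), stk false x y w.tail [] k o) (2 * w.length + 1)
        ((none, r'), stk false x y [] [] k o) by
    obtain ⟨r', hr', e⟩ := h w { r with flag := false }
    refine ⟨r', by simpa using hr', .seq (.act (t := 1) ?_ le_rfl) e (by omega)⟩
    simp [runOps, Op.run, popTop, change]
  intro w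
  induction w with
  | nil => exact fun r => ⟨r, by simp, .loop_done rfl le_rfl⟩
  | cons b w ih =>
    intro r
    obtain ⟨r', hr', e⟩ := ih { r with flag := r.flag || decide (some b ≠ some .sep) }
    refine ⟨r', by simpa [Bool.or_assoc] using hr', .loop_step (t₁ := 1) rfl (.act ?_ le_rfl) e
      (by simp; omega)⟩
    simp [runOps, Op.run, popTop]

theorem exec_clearProg {a : Option Symbol} :
    Exec clearProg ((a, r), stk false x y w [] k o) (2 * x.length + 2)
      ((none, r), stk false [] y w [] k o) := by
  suffices h : ∀ x : List Symbol, Exec (whileSome <| .act [popTop (.side false)])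
      ((x.head?, r), stk false x.tail y w [] k o) (2 * x.length + 1)
        ((none, r), stk false [] y w [] k o) from
    .seq (.act (t := 1) (by simp [runOps, Op.run, popTop]) le_rfl) (h x) (by omega)
  intro x
  induction x with
  | nil => exact .loop_done rfl le_rfl
  | cons b x ih =>
    exact .loop_step (t₁ := 1) rfl (.act (by simp [runOps, Op.run, popTop]) le_rfl) ih
      (by simp; omega)

theorem exec_writeProg {n : ℕ} (lab : Fin n → Fin n → Symbol) (L : List (Fin n × Fin n))
    {a : Option Symbol} :
    ∃ r' : View, Exec writeProg
      ((a, r), stk false ((backward L).flatMap (record lab)) y w [] k [])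
      (L.length * (4 * n + 7) + 2)
      ((none, r'), stk false [] y w [] k (L.flatMap fun p => encodeNat (recipient lab p))) := by
  suffices h : ∀ (L : List (Fin n × Fin n)) (o z : List Symbol) (r : View),
      z = (L.map Prod.swap).flatMap (record lab) →
      ∃ r' : View, Exec (whileSome <|
        .seq (.act [.pop (.side false) fun v a => (v.1, { v.2 with oth := a.getD .tick }),
          put .out .sep, popTop (.side false)]) <|
        .seq (.ite (fun v => decide (v.2.oth = .zero))
          (.seq (whileTick [put .out .tick, popTop (.side false)]) <|
            .seq (.act [popTop (.side false)]) <| whileTick [popTop (.side false)])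
          (.seq (whileTick [popTop (.side false)]) <|
            .seq (.act [popTop (.side false)]) <|
            whileTick [put .out .tick, popTop (.side false)])) <|
        .act [popTop (.side false)])
      ((z.head?, r), stk false z.tail y w [] k o) (L.length * (4 * n + 7) + 1)
      ((none, r'), stk false [] y w [] k
        (L.reverse.flatMap (fun p => encodeNat (recipient lab p)) ++ o)) by
    obtain ⟨r', e⟩ := h L.reverse [] _ r rfl
    rw [List.length_reverse, List.reverse_reverse, List.append_nil, List.map_reverse] at e
    exact ⟨r', .seq (.act (t := 1) (by simp [runOps, Op.run, popTop, backward]) le_rfl) e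
      (by omega)⟩
  intro L
  induction L with
  | nil =>
    rintro o z r rfl
    exact ⟨r, .loop_done rfl (by simp)⟩
  | cons p L ih =>
    rintro o z r rfl
    obtain ⟨i, j⟩ := p
    have hi := i.2
    have hj := j.2
    simp only [List.map_cons, List.flatMap_cons, List.reverse_cons, List.flatMap_append,
      List.flatMap_nil, List.append_nil, List.append_assoc, Prod.swap_prod_mk]
    set R := (L.map Prod.swap).flatMap (record lab) with hR
    set r₁ : View := { r with oth := lab i j } with hr₁
    obtain ⟨r', e⟩ := ih (encodeNat (recipient lab (i, j)) ++ o) _ r₁ rfl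
    refine ⟨r', .loop_step (t₁ := 4 * n + 6) (t₂ := L.length * (4 * n + 7) + 1) (by simp [record])
      (s' := ((R.head?, r₁), stk false R.tail y w [] k
        (encodeNat (recipient lab (i, j)) ++ o)))
      (.seq (t₁ := 1) (t₂ := 4 * n + 5) (s' := ((((encodeNat j ++ (encodeNat i ++ R)).head?), r₁),
          stk false (encodeNat j ++ (encodeNat i ++ R)).tail y w [] k (.sep :: o)))
        (.act ?_ le_rfl) (.seq (t₁ := 4 * n + 4) (s' := ((some .sep, r₁), stk false R y w [] k
        (encodeNat (recipient lab (i, j)) ++ o))) ?_ (.act (t := 1) ?_ le_rfl) ?_) ?_) e ?_⟩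
    · simp [runOps, Op.run, put, popTop, record, hr₁]
    · by_cases hz : lab i j = .zero
      · refine .ite_true (t₁ := 2 * n + 2 * n + 3) (by simp [hr₁, hz])
          (.seq (exec_copy_out j rfl) (.seq (.act (t := 1) ?_ le_rfl)
            (exec_skip i rfl) le_rfl) ?_) (by omega)
        · simp [runOps, Op.run, popTop, recipient, hz, encodeNat]
        · omega
      · refine .ite_false (t₁ := 2 * n + 2 * n + 3) (by simp [hr₁, hz])
          (.seq (exec_skip j rfl) (.seq (.act (t := 1) ?_ le_rfl)
            (by simpa [recipient, hz, encodeNat] using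
              exec_copy_out (r := r₁) (o := .sep :: o) (x := R) (y := y) (w := w) (k := k) i rfl)
              le_rfl) ?_) (by omega)
        · simp [runOps, Op.run, popTop, encodeNat]
        · omega
    · simp [runOps, Op.run, popTop]
    · omega
    · omega
    · simp
      ring_nf
      omega

end Reading

/-! ### Assigning edges to agents in need -/

section Orientation

variable {n : ℕ}

/-- The agents `i` with `U i` can be served: each of them gets an edge `i (g i)` that is available
to it, where `A i j` says that the edge `ij` is available to `i`. No edge is used twice, and this
means that `g` has no cycle of length two on these agents. -/
def Feasible (U : Fin n → Prop) (A : Fin n → Fin n → Prop) : Prop :=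
  ∃ g : Fin n → Fin n, ∀ i, U i → A i (g i) ∧ (U (g i) → g (g i) ≠ i)

/-- If at least two edges are available to each agent in need, with one exception `x`, to which at
least one is available, then all can be served: serving `x` by an edge `xj` takes an edge away from
`j` only, so that `j` becomes the exception. -/
theorem feasible_of_two (U : Finset (Fin n)) (A : Fin n → Fin n → Prop) (hA : ∀ i, ¬ A i i)
    (x : Fin n) (h₂ : ∀ i ∈ U, i ≠ x → ∃ j j', j ≠ j' ∧ A i j ∧ A i j')
    (h₁ : x ∈ U → ∃ j, A x j) : Feasible (· ∈ U) A := by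
  induction hm : U.card generalizing U A x with
  | zero =>
    rw [Finset.card_eq_zero] at hm
    subst hm
    exact ⟨id, by simp⟩
  | succ m ih =>
    wlog hx : x ∈ U generalizing x
    · obtain ⟨x', hx'⟩ : U.Nonempty := Finset.card_pos.1 (by omega)
      refine this x' (fun i hi _ => h₂ i hi fun e => hx (e ▸ hi)) (fun _ => ?_) hx'
      obtain ⟨j, _, _, hj, _⟩ := h₂ x' hx' fun e => hx (e ▸ hx')
      exact ⟨j, hj⟩
    obtain ⟨j, hj⟩ := h₁ hx
    have hjx : j ≠ x := fun e => hA x (e ▸ hj)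
    obtain ⟨g, hg⟩ := ih (U.erase x) (fun a b => A a b ∧ ¬ (a = j ∧ b = x))
      (fun i hi => hA i hi.1) j (fun i hi hij => by
        obtain ⟨hix, hi⟩ := Finset.mem_erase.1 hi
        obtain ⟨a, b, hab, ha, hb⟩ := h₂ i hi hix
        exact ⟨a, b, hab, ⟨ha, fun e => hij e.1⟩, hb, fun e => hij e.1⟩)
      (fun hjU => by
        obtain ⟨a, b, hab, ha, hb⟩ := h₂ j (Finset.mem_erase.1 hjU).2 hjx
        by_cases hax : a = x
        · exact ⟨b, hb, fun e => hab (hax.trans e.2.symm)⟩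
        · exact ⟨a, ha, fun e => hax e.2⟩)
      (by rw [Finset.card_erase_of_mem hx, hm]; rfl)
    refine ⟨update g x j, fun i hi => ?_⟩
    by_cases hix : i = x
    · subst hix
      simp only [update_self]
      refine ⟨hj, fun hjU e => ?_⟩
      rw [update_of_ne hjx] at e
      exact (hg j (Finset.mem_erase.2 ⟨hjx, hjU⟩)).1.2 ⟨rfl, e⟩
    · obtain ⟨⟨hAi, hi'⟩, hgi⟩ := hg i (Finset.mem_erase.2 ⟨hix, hi⟩)
      simp only [update_of_ne hix]
      refine ⟨hAi, fun hU e => ?_⟩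
      by_cases hgx : g i = x
      · rw [hgx, update_self] at e
        exact hi' ⟨e.symm, hgx⟩
      · rw [update_of_ne hgx] at e
        exact hgi (Finset.mem_erase.2 ⟨hgx, hU⟩) e

/-- The greedy choice is safe: an edge `ij` can be given to `i` if it is the only one available to
`i`, and also if at least two edges are available to each agent in need. -/
theorem Feasible.assign {U : Fin n → Prop} {A : Fin n → Fin n → Prop} (hA : ∀ i, ¬ A i i)
    (hF : Feasible U A) {i j : Fin n} (hi : U i) (hij : A i j)
    (h : (∀ j', A i j' → j' = j) ∨ ∀ k, U k → ∃ l l', l ≠ l' ∧ A k l ∧ A k l') :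
    Feasible (fun k => U k ∧ k ≠ i)
      (fun k l => A k l ∧ ¬ (k = i ∧ l = j) ∧ ¬ (k = j ∧ l = i)) := by
  classical
  rcases h with h | h
  · obtain ⟨g, hg⟩ := hF
    have hgi : g i = j := h _ (hg i hi).1
    refine ⟨g, fun k hk => ⟨⟨(hg k hk.1).1, fun e => hk.2 e.1, ?_⟩, fun e => (hg k hk.1).2 e.1⟩⟩
    rintro ⟨rfl, e⟩
    have := (hg i hi).2
    rw [hgi] at this
    exact this hk.1 e
  · have hji : j ≠ i := fun e => hA i (e ▸ hij)
    obtain ⟨g, hg⟩ := feasible_of_two (Finset.univ.filter fun k => U k ∧ k ≠ i)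
      (fun k l => A k l ∧ ¬ (k = i ∧ l = j) ∧ ¬ (k = j ∧ l = i)) (fun k hk => hA k hk.1) j
      (fun k hk hkj => by
        simp only [Finset.mem_filter, Finset.mem_univ, true_and] at hk
        obtain ⟨a, b, hab, ha, hb⟩ := h k hk.1
        exact ⟨a, b, hab, ⟨ha, fun e => hk.2 e.1, fun e => hkj e.1⟩, hb, fun e => hk.2 e.1,
          fun e => hkj e.1⟩)
      (fun hj => by
        simp only [Finset.mem_filter, Finset.mem_univ, true_and] at hj
        obtain ⟨a, b, hab, ha, hb⟩ := h j hj.1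
        by_cases hai : a = i
        · exact ⟨b, hb, fun e => hji e.1, fun e => hab (hai.trans e.2.symm)⟩
        · exact ⟨a, ha, fun e => hji e.1, fun e => hai e.2⟩)
    exact ⟨g, fun k hk => by simpa using hg k (by simpa using hk)⟩

end Orientation

/-! ### The effect of the sweeps -/

section Sweeps

variable {n : ℕ}

theorem Status.write_view (s : Status n) (p : Fin n × Fin n) : s.write p (s.view p) = s := by
  obtain ⟨f, lab, cell⟩ := s
  obtain ⟨a, b⟩ := p
  simp only [Status.write, Status.view, update_eq_self, Status.mk.injEq, and_true, true_and]
  funext i j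
  simp only [Prod.mk.injEq]
  split_ifs with h₁ h₂
  · rw [h₁.1, h₁.2]
  · rw [h₂.1, h₂.2]
  · rfl

/-- A local transition that changes only the cell of an agent, and this only in terms of the label
of the agent, acts on each cell separately. -/
theorem sweep_local {h : View → View} (γ : Symbol → Symbol → Symbol)
    (hh : ∀ r, h r = { r with cell := γ r.own r.cell }) (P : List (Fin n × Fin n))
    (s : Status n) : sweep h P s = { s with
      cell := fun i =>
        (darts P).foldl (fun c p => if p.1 = i then γ (s.lab i p.2) c else c) (s.cell i) } := by
  unfold sweep
  generalize darts P = D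
  induction D generalizing s with
  | nil => rfl
  | cons p D ih =>
    have hv : visit h s p =
        { s with cell := update s.cell p.1 (γ (s.lab p.1 p.2) (s.cell p.1)) } := by
      conv_rhs => rw [← s.write_view p]
      simp [visit, hh, Status.write, Status.view]
    rw [List.foldl_cons, hv, ih]
    congr 1
    funext i
    rw [List.foldl_cons]
    by_cases hi : p.1 = i
    · subst hi
      simp
    · simp [hi, update_of_ne (Ne.symm hi)]

theorem demand_eq (r : View) :
    demand r = { r with cell := if r.own = .one then .zero else r.cell } := by
  unfold demand
  split_ifs <;> rfl

theorem reset_eq (r : View) :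
    reset r = { r with cell := if r.cell = .sep then .sep else .zero } := by
  obtain ⟨f, a, b, c⟩ := r
  unfold reset
  simp only
  split_ifs with h
  · rw [h]
  · rfl

theorem tally_eq (r : View) :
    tally r = { r with cell := if r.own = .one then bump r.cell else r.cell } := by
  unfold tally
  split_ifs <;> rfl

theorem sweep_demand_lab (P : List (Fin n × Fin n)) (s : Status n) :
    (sweep demand P s).lab = s.lab := by
  rw [sweep_local (fun a c => if a = .one then .zero else c) demand_eq]

theorem sweep_demand_cell (P : List (Fin n × Fin n)) (s : Status n) (i : Fin n) :
    (sweep demand P s).cell i ≠ .sep ↔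
      s.cell i ≠ .sep ∨ ∃ j, (i, j) ∈ darts P ∧ s.lab i j = .one := by
  rw [sweep_local (fun a c => if a = .one then .zero else c) demand_eq]
  simp only
  generalize s.cell i = c
  generalize darts P = D
  induction D generalizing c with
  | nil => simp
  | cons p D ih =>
    rw [List.foldl_cons, ih]
    obtain ⟨a, b⟩ := p
    by_cases ha : a = i
    · subst ha
      by_cases hl : s.lab a b = .one
      · simp only [hl, if_true]
        exact ⟨fun _ => .inr ⟨b, by simp, hl⟩, fun _ => .inl (by simp)⟩
      · simp only [hl, if_true, if_false, List.mem_cons, Prod.mk.injEq, true_and]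
        refine or_congr Iff.rfl (exists_congr fun j => ?_)
        constructor
        · exact fun h => ⟨.inr h.1, h.2⟩
        · rintro ⟨rfl | h, h'⟩
          · exact absurd h' hl
          · exact ⟨h, h'⟩
    · have : ∀ j, ¬ (i = a ∧ j = b) := fun j e => ha e.1.symm
      simp [ha, this]

theorem foldl_reset (D : List (Fin n × Fin n)) (i : Fin n) (c : Symbol) :
    D.foldl (fun c p => if p.1 = i then (if c = .sep then .sep else .zero) else c) c =
      if c = .sep then .sep else if ∃ j, (i, j) ∈ D then .zero else c := by
  induction D generalizing c with
  | nil => simp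
  | cons p D ih =>
    obtain ⟨a, b⟩ := p
    rw [List.foldl_cons, ih]
    by_cases ha : a = i
    · subst ha
      by_cases hc : c = .sep
      · simp [hc]
      · have : ∃ j, (a, j) ∈ (a, b) :: D := ⟨b, by simp⟩
        rw [if_pos this]
        simp [hc]
    · have : ∀ j, ¬ (i = a ∧ j = b) := fun j e => ha e.1.symm
      simp [ha, this]

/-- The darts of the list `D` from `i` along which the label of `i` is `one`. -/
def options (lab : Fin n → Fin n → Symbol) (D : List (Fin n × Fin n)) (i : Fin n) :
    List (Fin n × Fin n) :=
  D.filter fun p => decide (p.1 = i ∧ lab i p.2 = .one)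

theorem mem_options {lab : Fin n → Fin n → Symbol} {D : List (Fin n × Fin n)} {i : Fin n}
    {p : Fin n × Fin n} : p ∈ options lab D i ↔ p ∈ D ∧ p.1 = i ∧ lab i p.2 = .one := by
  simp [options]

theorem foldl_tally (lab : Fin n → Fin n → Symbol) (D : List (Fin n × Fin n)) (i : Fin n)
    (c : Symbol) :
    D.foldl (fun c p => if p.1 = i then (if lab i p.2 = .one then bump c else c) else c) c =
      bump^[(options lab D i).length] c := by
  induction D generalizing c with
  | nil => rfl
  | cons p D ih =>
    rw [List.foldl_cons, ih]
    by_cases ha : p.1 = i <;> by_cases hl : lab i p.2 = .one <;> simp [options, ha, hl]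

theorem bump_iterate_sep (m : ℕ) : bump^[m] .sep = .sep := by
  induction m with
  | zero => rfl
  | succ m ih => rw [iterate_succ_apply', ih]; rfl

theorem bump_iterate_ne_sep (m : ℕ) {c : Symbol} (hc : c ≠ .sep) : bump^[m] c ≠ .sep := by
  induction m with
  | zero => exact hc
  | succ m ih =>
    rw [iterate_succ_apply']
    revert ih
    cases bump^[m] c <;> simp [bump]

theorem bump_iterate_zero (m : ℕ) : bump^[m + 2] .zero = .tick := by
  induction m with
  | zero => rfl
  | succ m ih => rw [show m + 1 + 2 = m + 2 + 1 from rfl, iterate_succ_apply', ih]; rfl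

/-- The labels after the edge `ij` has been given to `i`. -/
def assignLab (lab : Fin n → Fin n → Symbol) (i j : Fin n) : Fin n → Fin n → Symbol :=
  fun k l => if (k, l) = (i, j) then .tick else if (l, k) = (i, j) then .zero else lab k l

theorem foldl_pick_of_flag (c : Symbol) (D : List (Fin n × Fin n)) (s : Status n)
    (hs : s.flag = true) : D.foldl (visit (pick c)) s = s := by
  induction D with
  | nil => rfl
  | cons p D ih =>
    have : pick c (s.view p) = s.view p := by simp [pick, Status.view, hs]
    rw [List.foldl_cons, visit, this, s.write_view, ih]

/-- A sweep with `pick c` assigns an available edge to an agent with the counter `c`, if it finds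
one. -/
theorem sweep_pick (c : Symbol) (P : List (Fin n × Fin n)) (s : Status n)
    (hs : s.flag = false) :
    (sweep (pick c) P s = s ∧ ∀ i j, (i, j) ∈ darts P → s.lab i j = .one → s.cell i ≠ c) ∨
    ∃ i j, (i, j) ∈ darts P ∧ s.lab i j = .one ∧ s.cell i = c ∧
      sweep (pick c) P s = ⟨true, assignLab s.lab i j, update s.cell i .sep⟩ := by
  unfold sweep
  generalize darts P = D
  induction D with
  | nil => exact .inl ⟨rfl, by simp⟩
  | cons p D ih =>
    rw [List.foldl_cons]
    by_cases h : s.lab p.1 p.2 = .one ∧ s.cell p.1 = c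
    · refine .inr ⟨p.1, p.2, by simp, h.1, h.2, ?_⟩
      have : pick c (s.view p) = ⟨true, .tick, .zero, .sep⟩ := by
        simp [pick, Status.view, hs, h.1, h.2]
      rw [visit, this, foldl_pick_of_flag _ _ _ rfl]
      rfl
    · have : pick c (s.view p) = s.view p := if_neg fun e => h ⟨e.1, e.2.1⟩
      rw [visit, this, s.write_view]
      rcases ih with ⟨h₁, h₂⟩ | ⟨i, j, hij, h₁⟩
      · refine .inl ⟨h₁, fun i j hij hl hc => ?_⟩
        rcases List.mem_cons.1 hij with rfl | hij
        · exact h ⟨hl, hc⟩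
        · exact h₂ i j hij hl hc
      · exact .inr ⟨i, j, List.mem_cons_of_mem _ hij, h₁⟩

end Sweeps

/-! ### The greedy algorithm is correct -/

section Greedy

variable {n : ℕ} {L : List (Fin n × Fin n)} {Adj : Fin n → Fin n → Prop}

/-- The edge `ij` is available to `i`, and `i` has the value one for it. -/
def Avail (Adj : Fin n → Fin n → Prop) (s : Status n) (i j : Fin n) : Prop :=
  Adj i j ∧ s.lab i j = .one

/-- A round either assigns an edge according to the greedy rule, or there is no edge available to
an agent in need. -/
theorem greedyRound_spec (hL : (darts L).Nodup) (hAdj : ∀ i j, (i, j) ∈ darts L ↔ Adj i j)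
    (s : Status n) :
    (∃ i j, Avail Adj s i j ∧ s.cell i ≠ .sep ∧
      ((∀ j', Avail Adj s i j' → j' = j) ∨
        ∀ k, s.cell k ≠ .sep → (∃ l, Avail Adj s k l) →
          ∃ l l', l ≠ l' ∧ Avail Adj s k l ∧ Avail Adj s k l') ∧
      (greedyRound L s).lab = assignLab s.lab i j ∧
      ∀ k, (greedyRound L s).cell k = .sep ↔ s.cell k = .sep ∨ k = i) ∨
    ((greedyRound L s).lab = s.lab ∧ (∀ k, (greedyRound L s).cell k = .sep ↔ s.cell k = .sep) ∧
      ∀ i, s.cell i ≠ .sep → ∀ j, ¬ Avail Adj s i j) := by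
  have hb : ∀ p, p ∈ darts (backward L) ↔ p ∈ darts L := by
    intro p
    rw [darts_backward, List.mem_reverse]
  set t := sweep tally L (sweep reset (backward L) { s with flag := false }) with ht
  have hround : greedyRound L s = sweep (pick .tick) L (sweep (pick .one) (backward L) t) := rfl
  have ht' : t = ⟨false, s.lab, fun i => bump^[(options s.lab (darts L) i).length]
      (if s.cell i = .sep then .sep else if ∃ j, (i, j) ∈ darts L then .zero else s.cell i)⟩ := by
    rw [ht, sweep_local (fun a c => if a = .one then bump c else c) tally_eq,
      sweep_local (fun _ c => if c = .sep then .sep else .zero) reset_eq]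
    simp only [foldl_reset, foldl_tally, hb]
  have htf : t.flag = false := by rw [ht']
  have htl : t.lab = s.lab := by rw [ht']
  have hsep : ∀ k, t.cell k = .sep ↔ s.cell k = .sep := by
    intro k
    rw [ht']
    by_cases hk : s.cell k = .sep
    · simp [hk, bump_iterate_sep]
    · simp only [hk, if_false, iff_false]
      exact bump_iterate_ne_sep _ (by split_ifs <;> simp_all)
  have hcount : ∀ k, s.cell k ≠ .sep → ∀ l, Adj k l →
      t.cell k = bump^[(options s.lab (darts L) k).length] .zero := by
    intro k hk l hkl
    have : ∃ j, (k, j) ∈ darts L := ⟨l, (hAdj k l).2 hkl⟩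
    simp [ht', hk, this]
  have hopt : ∀ k l, (k, l) ∈ options s.lab (darts L) k ↔ Avail Adj s k l := by
    intro k l
    rw [mem_options, hAdj]
    simp [Avail]
  have hfst : ∀ k, ∀ p ∈ options s.lab (darts L) k, p.1 = k := fun k p hp => (mem_options.1 hp).2.1
  -- the meaning of the counters of agents in need
  have htwo : ∀ k, s.cell k ≠ .sep → (∃ l, Avail Adj s k l) → t.cell k ≠ .one →
      t.cell k = .tick ∧ ∃ l l', l ≠ l' ∧ Avail Adj s k l ∧ Avail Adj s k l' := by
    rintro k hk ⟨l, hl⟩ hone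
    have hc := hcount k hk l hl.1
    have hmem := (hopt k l).2 hl
    have hnd : (options s.lab (darts L) k).Nodup := hL.filter _
    have h1 := hfst k
    have ho := hopt k
    revert hc hmem hnd h1 ho
    generalize options s.lab (darts L) k = O
    intro hc hmem hnd h1 ho
    match O with
    | [] => simp at hmem
    | [p] => exact absurd hc hone
    | p :: q :: O =>
      refine ⟨hc.trans (bump_iterate_zero _), p.2, q.2, ?_, ?_, ?_⟩
      · intro e
        have hpq : p = q := Prod.ext ((h1 p (by simp)).trans (h1 q (by simp)).symm) e
        simp [hpq] at hnd
      · exact (ho p.2).1 (by rw [← h1 p (by simp)]; simp)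
      · exact (ho q.2).1 (by rw [← h1 q (by simp)]; simp)
  have hunique : ∀ k, s.cell k ≠ .sep → ∀ l, Avail Adj s k l → t.cell k = .one →
      ∀ l', Avail Adj s k l' → l' = l := by
    intro k hk l hl hone l' hl'
    have hc := hcount k hk l hl.1
    have hm := (hopt k l).2 hl
    have hm' := (hopt k l').2 hl'
    revert hc hm hm'
    generalize options s.lab (darts L) k = O
    intro hc hm hm'
    match O with
    | [] => simp at hm
    | [p] =>
      simp only [List.mem_singleton] at hm hm'
      exact congrArg Prod.snd (hm'.trans hm.symm)
    | p :: q :: O =>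
      rw [List.length_cons, List.length_cons, bump_iterate_zero, hone] at hc
      cases hc
  have hcell : ∀ i k, update t.cell i .sep k = .sep ↔ s.cell k = .sep ∨ k = i := by
    intro i k
    by_cases hk : k = i
    · simp [hk]
    · rw [update_of_ne hk, hsep]
      simp [hk]
  rcases sweep_pick .one (backward L) t htf with ⟨h₁, h₁'⟩ | ⟨i, j, hij, hl, hc, h₁⟩
  · rcases sweep_pick .tick L t htf with ⟨h₂, h₂'⟩ | ⟨i, j, hij, hl, hc, h₂⟩
    · right
      rw [hround, h₁, h₂]
      refine ⟨htl, hsep, fun i hi j hij => ?_⟩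
      have hd := (hAdj i j).2 hij.1
      have hl : t.lab i j = .one := by rw [htl]; exact hij.2
      exact h₂' i j hd hl (htwo i hi ⟨j, hij⟩ (h₁' i j ((hb _).2 hd) hl)).1
    · left
      rw [htl] at hl
      have hi : s.cell i ≠ .sep := by rw [Ne, ← hsep, hc]; simp
      refine ⟨i, j, ⟨(hAdj i j).1 hij, hl⟩, hi, .inr fun k hk hkl => ?_, ?_⟩
      · obtain ⟨l, hl⟩ := hkl
        exact (htwo k hk ⟨l, hl⟩ (h₁' k l ((hb _).2 ((hAdj k l).2 hl.1))
          (by rw [htl]; exact hl.2))).2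
      · rw [hround, h₁, h₂, htl]
        exact ⟨rfl, hcell i⟩
  · left
    rw [htl] at hl
    have hi : s.cell i ≠ .sep := by rw [Ne, ← hsep, hc]; simp
    have hA : Avail Adj s i j := ⟨(hAdj i j).1 ((hb _).1 hij), hl⟩
    refine ⟨i, j, hA, hi, .inl (hunique i hi j hA hc), ?_⟩
    rw [hround, h₁, show sweep (pick .tick) L ⟨true, assignLab t.lab i j, update t.cell i .sep⟩ = _ from
      foldl_pick_of_flag _ _ _ rfl, htl]
    exact ⟨rfl, hcell i⟩

/-- A round keeps the agents in need servable, and serves one of them. -/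
theorem Feasible.greedyRound (hL : (darts L).Nodup) (hAdj : ∀ i j, (i, j) ∈ darts L ↔ Adj i j)
    (hirr : ∀ i, ¬ Adj i i) {s : Status n}
    (hF : Feasible (fun i => s.cell i ≠ .sep) (Avail Adj s)) :
    Feasible (fun i => (greedyRound L s).cell i ≠ .sep) (Avail Adj (greedyRound L s)) ∧
      ((∀ i, s.cell i = .sep) ∨
        ∃ i, s.cell i ≠ .sep ∧
          ∀ k, (FairDivision.greedyRound L s).cell k = .sep ↔ s.cell k = .sep ∨ k = i) := by
  have hav : ∀ k, s.cell k ≠ .sep → ∃ l, Avail Adj s k l := by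
    obtain ⟨g, hg⟩ := hF
    exact fun k hk => ⟨g k, (hg k hk).1⟩
  rcases greedyRound_spec hL hAdj s with ⟨i, j, hij, hi, h, hlab, hcell⟩ | ⟨hlab, hcell, h⟩
  · refine ⟨?_, .inr ⟨i, hi, hcell⟩⟩
    have hF' := hF.assign (fun k hk => hirr k hk.1) hi hij
      (h.imp_right fun h k hk => h k hk (hav k hk))
    obtain ⟨g, hg⟩ := hF'
    have hU : ∀ k, (FairDivision.greedyRound L s).cell k ≠ .sep ↔ s.cell k ≠ .sep ∧ k ≠ i := by
      intro k
      rw [Ne, hcell, not_or]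
    refine ⟨g, fun k hk => ?_⟩
    obtain ⟨⟨h₁, h₂, h₃⟩, h₄⟩ := hg k ((hU k).1 hk)
    refine ⟨⟨h₁.1, ?_⟩, fun hgk => h₄ ((hU _).1 hgk)⟩
    rw [hlab, assignLab, if_neg (by simpa using h₂), if_neg (by simpa [and_comm] using h₃)]
    exact h₁.2
  · refine ⟨?_, .inl fun k => ?_⟩
    · obtain ⟨g, hg⟩ := hF
      refine ⟨g, fun k hk => ?_⟩
      obtain ⟨h₁, h₂⟩ := hg k fun e => hk ((hcell k).2 e)
      exact ⟨⟨h₁.1, by rw [hlab]; exact h₁.2⟩, fun hgk => h₂ fun e => hgk ((hcell _).2 e)⟩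
    · by_contra hk
      obtain ⟨l, hl⟩ := hav k hk
      exact h k hk l hl

/-- If the agents in need can be served, then the greedy algorithm serves all of them. -/
theorem Feasible.iterate_greedyRound (hL : (darts L).Nodup)
    (hAdj : ∀ i j, (i, j) ∈ darts L ↔ Adj i j) (hirr : ∀ i, ¬ Adj i i) (m : ℕ) (s : Status n)
    (hF : Feasible (fun i => s.cell i ≠ .sep) (Avail Adj s))
    (hm : (Finset.univ.filter fun i => s.cell i ≠ .sep).card ≤ m) (i : Fin n) :
    ((FairDivision.greedyRound L)^[m] s).cell i = .sep := by
  induction m generalizing s with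
  | zero =>
    by_contra hi
    rw [Nat.le_zero, Finset.card_eq_zero] at hm
    exact Finset.notMem_empty i (hm ▸ Finset.mem_filter.2 ⟨Finset.mem_univ i, hi⟩)
  | succ m ih =>
    obtain ⟨hF', h⟩ := hF.greedyRound hL hAdj hirr
    rw [iterate_succ_apply]
    refine ih _ hF' ?_
    rcases h with h | ⟨j, hj, h⟩
    · have : ∀ k, (FairDivision.greedyRound L s).cell k = .sep := by
        intro k
        rcases greedyRound_spec hL hAdj s with ⟨i, j, _, _, _, _, hc⟩ | ⟨_, hc, _⟩
        · exact (hc k).2 (.inl (h k))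
        · exact (hc k).2 (h k)
      simp [this]
    · have hs : (Finset.univ.filter fun k => (FairDivision.greedyRound L s).cell k ≠ .sep) =
          (Finset.univ.filter fun k => s.cell k ≠ .sep).erase j := by
        ext k
        simp [h, and_comm]
      rw [hs, Finset.card_erase_of_mem (by simpa using hj)]
      omega

/-- The invariant of the run, where `val` are the values of the ends: each edge is still available, with its labels being the values, or it
has been assigned to an end with value one; and each agent with an edge of value one is still in
need or has got an edge. -/
structure Sound (Adj : Fin n → Fin n → Prop) (val : Fin n → Fin n → Symbol) (s : Status n) :
    Prop where
  lab : ∀ i j, Adj i j → (s.lab i j = val i j ∧ s.lab j i = val j i) ∨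
    (s.lab i j = .tick ∧ s.lab j i = .zero ∧ val i j = .one) ∨
    (s.lab j i = .tick ∧ s.lab i j = .zero ∧ val j i = .one)
  cell : ∀ i, (∃ j, Adj i j ∧ val i j = .one) → s.cell i = .sep →
    ∃ j, Adj i j ∧ s.lab i j = .tick

theorem Sound.greedyRound (hL : (darts L).Nodup) (hAdj : ∀ i j, (i, j) ∈ darts L ↔ Adj i j)
    (hirr : ∀ i, ¬ Adj i i) {val : Fin n → Fin n → Symbol}
    (hval : ∀ i j, val i j ≠ .tick) {s : Status n}
    (hs : Sound Adj val s) : Sound Adj val (greedyRound L s) := by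
  rcases greedyRound_spec hL hAdj s with ⟨i, j, hij, hi, -, hlab, hcell⟩ | ⟨hlab, hcell, -⟩
  · have hne : i ≠ j := fun e => hirr i (e ▸ hij.1)
    have hji : s.lab j i = val j i ∧ val i j = .one := by
      rcases hs.lab i j hij.1 with h | h | h
      · exact ⟨h.2, h.1.symm.trans hij.2⟩
      · rw [hij.2] at h
        simp at h
      · rw [hij.2] at h
        simp at h
    have e₁ : assignLab s.lab i j i j = .tick := by simp [assignLab]
    have e₂ : assignLab s.lab i j j i = .zero := by simp [assignLab, hne]
    have e₃ : ∀ a b, (a, b) ≠ (i, j) → (b, a) ≠ (i, j) → assignLab s.lab i j a b = s.lab a b := by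
      intro a b h₁ h₂
      rw [assignLab, if_neg h₁, if_neg h₂]
    constructor
    · intro a b hab
      rw [hlab]
      by_cases h₁ : (a, b) = (i, j)
      · obtain ⟨rfl, rfl⟩ := Prod.mk.inj h₁
        exact .inr (.inl ⟨e₁, e₂, hji.2⟩)
      · by_cases h₂ : (b, a) = (i, j)
        · obtain ⟨rfl, rfl⟩ := Prod.mk.inj h₂
          exact .inr (.inr ⟨e₁, e₂, hji.2⟩)
        · rw [e₃ a b h₁ h₂, e₃ b a h₂ h₁]
          exact hs.lab a b hab
    · intro a ha hc
      rw [hlab]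
      by_cases hai : a = i
      · subst hai
        exact ⟨j, hij.1, e₁⟩
      · rcases (hcell a).1 hc with hc | hc
        · obtain ⟨b, hab, hb⟩ := hs.cell a ha hc
          refine ⟨b, hab, ?_⟩
          rw [e₃ a b (fun e => hai (Prod.mk.inj e).1), hb]
          intro e
          obtain ⟨rfl, rfl⟩ := Prod.mk.inj e
          exact hval a b (hji.1.symm.trans hb)
        · exact absurd hc hai
  · constructor
    · rw [hlab]
      exact hs.lab
    · intro a ha hc
      rw [hlab]
      exact hs.cell a ha ((hcell a).1 hc)

/-- The state before the first round: the agents in need are those with an edge of value one. -/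
theorem sweep_demand_twice (hAdj : ∀ i j, (i, j) ∈ darts L ↔ Adj i j)
    (val : Fin n → Fin n → Symbol) :
    (sweep demand L (sweep demand (backward L) ⟨false, val, fun _ => .sep⟩)).lab = val ∧
    ∀ i, (sweep demand L (sweep demand (backward L) ⟨false, val, fun _ => .sep⟩)).cell i ≠ .sep ↔
      ∃ j, Adj i j ∧ val i j = .one := by
  refine ⟨by rw [sweep_demand_lab, sweep_demand_lab], fun i => ?_⟩
  rw [sweep_demand_cell, sweep_demand_cell, sweep_demand_lab, darts_backward]
  simp [hAdj]

/-- The outcome of the greedy algorithm is sound. -/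
theorem sound_greedy (hL : (darts L).Nodup) (hAdj : ∀ i j, (i, j) ∈ darts L ↔ Adj i j)
    (hirr : ∀ i, ¬ Adj i i) {val : Fin n → Fin n → Symbol}
    (hval : ∀ i j, val i j ≠ .tick) : Sound Adj val (greedy L val) := by
  obtain ⟨hlab, hcell⟩ := sweep_demand_twice hAdj val
  have h : ∀ m s, Sound Adj val s → Sound Adj val ((FairDivision.greedyRound L)^[m] s) := by
    intro m
    induction m with
    | zero => exact fun s hs => hs
    | succ m ih => exact fun s hs => ih _ (hs.greedyRound hL hAdj hirr hval)
  refine h _ _ ⟨fun i j _ => .inl ?_, fun i hi hc => absurd hc ((hcell i).2 hi)⟩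
  rw [hlab]
  exact ⟨rfl, rfl⟩

/-- If all agents with an edge of value one can be served, then the greedy algorithm leaves no
agent in need. -/
theorem greedy_cell (hL : (darts L).Nodup) (hAdj : ∀ i j, (i, j) ∈ darts L ↔ Adj i j)
    (hirr : ∀ i, ¬ Adj i i) {val : Fin n → Fin n → Symbol}
    (hF : Feasible (fun i => ∃ j, Adj i j ∧ val i j = .one)
      (fun i j => Adj i j ∧ val i j = .one)) (i : Fin n) :
    (greedy L val).cell i = .sep := by
  obtain ⟨hlab, hcell⟩ := sweep_demand_twice hAdj val
  refine Feasible.iterate_greedyRound hL hAdj hirr n _ ?_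
    ((Finset.card_le_univ _).trans (by simp)) i
  simp only [hcell]
  unfold Avail
  rw [hlab]
  exact hF

end Greedy

/-! ### The run of the machine -/

/-- The answer of the algorithm for the list `L` of edges, with the values `val`, as a word. -/
def answerWord {n : ℕ} (L : List (Fin n × Fin n)) (val : Fin n → Fin n → Symbol) : List Symbol :=
  if (List.ofFn (greedy L val).cell).any (fun c => decide (c ≠ .sep)) then [.zero]
  else .one :: L.flatMap fun p => encodeNat (recipient (greedy L val).lab p)

theorem length_flatMap_record_le {n : ℕ} (lab : Fin n → Fin n → Symbol)
    (P : List (Fin n × Fin n)) : (P.flatMap (record lab)).length ≤ P.length * (2 * n + 4) := by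
  induction P with
  | nil => simp
  | cons p P ih =>
    have h₁ := p.1.2
    have h₂ := p.2.2
    simp only [List.flatMap_cons, List.length_append, List.length_cons, record, encodeNat,
      List.length_replicate, List.length_nil]
    ring_nf at ih ⊢
    omega

/-- A bound for the running time, for `n` agents and `m` edges. -/
def timeBound (n m : ℕ) : ℕ :=
  n * (4 * (m * (8 * n + 11)) + 11) + 2 * (m * (8 * n + 11)) + 3 * (m * (4 * n + 8)) + 4 * n + 20

/-- The machine computes the answer of the greedy algorithm, with the register and all other stacks
restored at the end. -/
theorem exec_mainProg {n : ℕ} {L : List (Fin n × Fin n)} (hL : (darts L).Nodup)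
    (val : Fin n → Fin n → Symbol) :
    Exec mainProg
      (register₀, update (fun _ => []) (.side true) (encodeNat n ++ L.flatMap (inputRecord val)))
      (timeBound n L.length)
      (register₀, update (fun _ => []) .out (answerWord L val)) := by
  have hE : (fun _ => [] : Stack → List Symbol) = stk true [] [] [] [] [] [] := by
    funext s
    cases s <;> simp [stk]
  rw [hE, update_stk_side, if_pos rfl, update_stk_out]
  have hb := nodup_darts_backward hL
  have e₁ := exec_readAgents (x := L.flatMap (inputRecord val)) (y := []) (o := [])
    (r := register₀.2) n (a := none)
  have e₂ := exec_readEdges (w := List.replicate n .sep) (k := List.replicate n .tick) (o := [])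
    (r := register₀.2) val L (a := some .sep)
  have h₀ : Holds false (backward L) ⟨false, val, fun _ => .sep⟩ (List.replicate n .tick)
      ((none, register₀.2), stk true [] ((backward L).flatMap (record val))
        (List.replicate n .sep) [] (List.replicate n .tick) []) := by
    refine ⟨none, register₀.2, rfl, ?_⟩
    rw [← stk_not, List.ofFn_const]
    rfl
  obtain ⟨c₁, h₁, e₃⟩ := h₀.sweep demand hb
  rw [backward_backward] at h₁
  obtain ⟨c₂, h₂, e₄⟩ := h₁.sweep demand hL
  obtain ⟨c₃, h₃, e₅⟩ := exec_rounds hL n h₂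
  have hg : (greedyRound L)^[n] (sweep demand L (sweep demand (backward L)
    ⟨false, val, fun _ => .sep⟩)) = greedy L val := rfl
  rw [hg] at h₃
  obtain ⟨a, r, -, rfl⟩ := h₃
  obtain ⟨r', hr', e₆⟩ := exec_checkProg (x := (backward L).flatMap (record (greedy L val).lab))
    (y := []) (w := List.ofFn (greedy L val).cell) (k := []) (o := []) (r := r) (a := a)
  have e₇ : ∃ v, Exec (.ite (fun v => v.2.flag) (.seq clearProg (.act [put .out .zero]))
      (.seq writeProg (.act [put .out .one])))
      ((none, r'), stk false ((backward L).flatMap (record (greedy L val).lab)) [] [] [] [] [])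
      (2 * (L.length * (4 * n + 8)) + 4) (v, stk true [] [] [] [] [] (answerWord L val)) := by
    by_cases hfail : (List.ofFn (greedy L val).cell).any (fun c => decide (c ≠ .sep)) = true
    · refine ⟨(none, r'), .ite_true (hr'.trans hfail) (.seq exec_clearProg (.act (t := 1) ?_ le_rfl)
        le_rfl) ?_⟩
      · rw [answerWord, if_pos hfail, ← Bool.not_false, stk_not]
        simp [runOps, Op.run, put]
      · have := length_flatMap_record_le (greedy L val).lab (backward L)
        rw [length_backward] at this
        ring_nf at this ⊢
        omega
    · obtain ⟨r'', e⟩ := exec_writeProg (greedy L val).lab L (y := []) (w := []) (k := [])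
        (r := r') (a := none)
      refine ⟨(none, r''), .ite_false (hr'.trans (Bool.eq_false_iff.2 hfail))
        (.seq e (.act (t := 1) ?_ le_rfl) le_rfl) ?_⟩
      · rw [answerWord, if_neg hfail, ← Bool.not_false, stk_not]
        simp [runOps, Op.run, put]
      · ring_nf
        omega
  obtain ⟨v, e₇⟩ := e₇
  refine .seq e₁ (.seq e₂ (.seq e₃ (.seq e₄ (.seq e₅ (.seq e₆ (.seq e₇ (.act (t := 1) rfl le_rfl)
    le_rfl) le_rfl) le_rfl) le_rfl) le_rfl) le_rfl) ?_
  rw [length_backward, List.length_ofFn, timeBound]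
  ring_nf
  omega

/-! ### Envy-free allocations of binary graphical instances, and the answer of the machine -/

section Instances

theorem encodeValue_ne_tick (x : ℝ≥0) : encodeValue x ≠ .tick := by
  unfold encodeValue
  split_ifs <;> simp

theorem encodeValue_eq_one {x : ℝ≥0} : encodeValue x = .one ↔ x ≠ 0 := by
  unfold encodeValue
  split_ifs with h <;> simp [h]

namespace GraphicalInstance

variable (I : GraphicalInstance)

/-- The symbol for the value of the agent `i` for the edge `ij`. -/
noncomputable def val (i j : Fin I.n) : Symbol := encodeValue (I.value i j)

variable {I}

theorem val_eq_one {i j : Fin I.n} (h : I.G.Adj i j) : I.val i j = .one ↔ I.u i (I.edge h) ≠ 0 := by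
  rw [val, encodeValue_eq_one, value, dif_pos h]

theorem nodup_edgeList : I.edgeList.Nodup :=
  ((List.nodup_finRange _).product (List.nodup_finRange _)).filter _

theorem mem_darts_edgeList (i j : Fin I.n) : (i, j) ∈ darts I.edgeList ↔ I.G.Adj i j := by
  simp only [mem_darts, mem_edgeList, Prod.swap_prod_mk]
  constructor
  · rintro (h | h)
    · exact h.2
    · exact h.2.symm
  · intro h
    rcases lt_or_gt_of_ne h.ne with hij | hij
    · exact .inl ⟨hij, h⟩
    · exact .inr ⟨hij, h.symm⟩

theorem nodup_darts_edgeList : (darts I.edgeList).Nodup := by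
  have h : ∀ P : List (Fin I.n × Fin I.n), P.Nodup → (∀ p ∈ P, p.1 < p.2) → (darts P).Nodup := by
    intro P
    induction P with
    | nil => simp [darts]
    | cons p P ih =>
      intro hP hlt
      rw [List.nodup_cons] at hP
      have hp := hlt p (by simp)
      have hlt' : ∀ q ∈ P, q.1 < q.2 := fun q hq => hlt q (List.mem_cons_of_mem _ hq)
      change (p :: p.swap :: darts P).Nodup
      rw [List.nodup_cons, List.nodup_cons, List.mem_cons, not_or, mem_darts, mem_darts,
        Prod.swap_swap]
      have hs : p.swap ∉ P := fun h => lt_asymm hp (hlt' _ h)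
      refine ⟨⟨fun e => ?_, ?_⟩, ?_, ih hP.2 hlt'⟩
      · exact hp.ne (congrArg Prod.fst e)
      · simp [hP.1, hs]
      · simp [hP.1, hs]
  exact h _ nodup_edgeList fun p hp => ((I.mem_edgeList p).1 hp).1

theorem item_eq_edge (e : I.Item) {i j : Fin I.n} (hi : i ∈ (e : Sym2 (Fin I.n)))
    (hj : j ∈ (e : Sym2 (Fin I.n))) (hij : i ≠ j) : ∃ h : I.G.Adj i j, e = I.edge h := by
  obtain ⟨e, he⟩ := e
  obtain rfl : e = s(i, j) := (Sym2.mem_and_mem_iff hij).1 ⟨hi, hj⟩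
  exact ⟨he, rfl⟩

theorem edge_swap {i j : Fin I.n} (h : I.G.Adj i j) : I.edge h = I.edge h.symm :=
  Subtype.ext Sym2.eq_swap

/-- The allocation that is read off from the labels of the edges. -/
noncomputable def allocation (lab : Fin I.n → Fin I.n → Symbol) : I.Allocation := fun e =>
  recipient lab ((e : Sym2 (Fin I.n)).inf, (e : Sym2 (Fin I.n)).sup)

theorem allocation_edge (lab : Fin I.n → Fin I.n → Symbol) {i j : Fin I.n} (hij : i < j)
    (h : I.G.Adj i j) : allocation lab (I.edge h) = recipient lab (i, j) := by
  simp [allocation, edge, hij.le]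

theorem allocation_mem (lab : Fin I.n → Fin I.n → Symbol) (e : I.Item) :
    allocation lab e ∈ (e : Sym2 (Fin I.n)) := by
  obtain ⟨e, he⟩ := e
  induction e using Sym2.ind with
  | _ i j =>
    have h : I.G.Adj i j := he
    rcases lt_or_gt_of_ne h.ne with hij | hij
    · change allocation lab (I.edge h) ∈ s(i, j)
      rw [allocation_edge lab hij, recipient]
      split_ifs <;> simp
    · change allocation lab (I.edge h) ∈ s(i, j)
      rw [edge_swap h, allocation_edge lab hij, recipient]
      split_ifs <;> simp

theorem allocation_of_tick {s : Status I.n} (hs : Sound I.G.Adj I.val s) {i j : Fin I.n}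
    (h : I.G.Adj i j) (ht : s.lab i j = .tick) :
    allocation s.lab (I.edge h) = i ∧ I.val i j = .one := by
  have h' : s.lab j i = .zero ∧ I.val i j = .one := by
    rcases hs.lab i j h with h | h | h
    · exact absurd (h.1.symm.trans ht) (encodeValue_ne_tick _)
    · exact h.2
    · rw [ht] at h
      simp at h
  refine ⟨?_, h'.2⟩
  rcases lt_or_gt_of_ne h.ne with hij | hij
  · rw [allocation_edge _ hij, recipient, ht, if_neg (by simp)]
  · rw [edge_swap h, allocation_edge _ hij, recipient, h'.1, if_pos rfl]

end GraphicalInstance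

open GraphicalInstance

variable {I : BinaryGraphicalInstance}

/-- If every edge goes to one of its ends, and every agent with an edge of value one gets an edge of
value one, then there is no envy: a bundle of another agent contains at most one edge of positive
value, the edge between the two. -/
theorem isEF_allocation {s : Status I.n} (hs : Sound I.G.Adj I.val s)
    (hcell : ∀ i, s.cell i = .sep) : I.IsEF (allocation s.lab) := by
  intro i j
  by_cases hij : i = j
  · rw [hij]
  by_cases h0 : ∀ e ∈ bundle (allocation s.lab) j, I.u i e = 0
  · rw [utility, Finset.sum_eq_zero h0]
    exact zero_le
  push Not at h0
  have hmem : ∀ e ∈ bundle (allocation s.lab) j, I.u i e ≠ 0 →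
      ∃ h : I.G.Adj i j, e = I.edge h := by
    intro e he hu
    have hi : i ∈ (e : Sym2 (Fin I.n)) := by
      by_contra hi
      exact hu (I.u_eq_zero i e hi)
    have hj : j ∈ (e : Sym2 (Fin I.n)) := by
      have := allocation_mem s.lab e
      rwa [(Finset.mem_filter.1 he).2] at this
    exact item_eq_edge e hi hj hij
  obtain ⟨e, he, hu⟩ := h0
  obtain ⟨h, rfl⟩ := hmem e he hu
  have hle : utility I.u i (bundle (allocation s.lab) j) = 1 := by
    rw [utility, Finset.sum_eq_single (I.edge h)]
    · exact (I.binary i _).resolve_left hu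
    · intro e' he' hne
      by_contra hu'
      exact hne (hmem e' he' hu').2
    · exact fun hn => absurd he hn
  obtain ⟨k, hk, ht⟩ := hs.cell i ⟨j, h, (val_eq_one h).2 hu⟩ (hcell i)
  obtain ⟨hΦ, hv⟩ := allocation_of_tick hs hk ht
  rw [hle, ← (I.binary i (I.edge hk)).resolve_left ((val_eq_one hk).1 hv)]
  exact Finset.single_le_sum (f := fun e => I.u i e) (fun _ _ => zero_le)
    (Finset.mem_filter.2 ⟨Finset.mem_univ _, hΦ⟩)

/-- In an envy-free allocation every agent with an edge of positive value gets one. -/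
theorem feasible_of_isEF {Φ : I.Allocation} (hΦ : I.IsEF Φ) :
    Feasible (fun i => ∃ j, I.G.Adj i j ∧ I.val i j = .one)
      (fun i j => I.G.Adj i j ∧ I.val i j = .one) := by
  have key : ∀ i, (∃ j, I.G.Adj i j ∧ I.val i j = .one) →
      ∃ k, ∃ h : I.G.Adj i k, I.val i k = .one ∧ Φ (I.edge h) = i := by
    rintro i ⟨j, h, hv⟩
    have hpos : 0 < utility I.u i (bundle Φ (Φ (I.edge h))) :=
      (pos_iff_ne_zero.2 ((val_eq_one h).1 hv)).trans_le
        (Finset.single_le_sum (f := fun e => I.u i e) (fun _ _ => zero_le)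
          (Finset.mem_filter.2 ⟨Finset.mem_univ _, rfl⟩))
    obtain ⟨e, he, hu⟩ := Finset.exists_ne_zero_of_sum_ne_zero (hpos.trans_le (hΦ i _)).ne'
    have hi : i ∈ (e : Sym2 (Fin I.n)) := by
      by_contra hi
      exact hu (I.u_eq_zero i e hi)
    obtain ⟨e, hG⟩ := e
    obtain ⟨k, rfl⟩ := hi
    exact ⟨k, hG, (val_eq_one (I := I.toGraphicalInstance) hG).2 hu, (Finset.mem_filter.1 he).2⟩
  choose! g hg using key
  refine ⟨g, fun i hi => ?_⟩
  obtain ⟨h, hv, hi'⟩ := hg i hi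
  refine ⟨⟨h, hv⟩, fun hgi e => ?_⟩
  obtain ⟨h₂, hv₂, hi₂⟩ := hg (g i) hgi
  have : I.edge h₂ = I.edge h := by
    refine Subtype.ext ?_
    change s(g i, g (g i)) = s(i, g i)
    rw [e]
    exact Sym2.eq_swap
  rw [this, hi'] at hi₂
  exact h.ne hi₂

open Classical in
/-- The answer of the algorithm: the allocation that the greedy algorithm has found, unless it has
left an agent in need. -/
noncomputable def answer (I : BinaryGraphicalInstance) : Option I.Allocation :=
  if ∀ i, (greedy I.edgeList I.val).cell i = .sep then
    some (allocation (greedy I.edgeList I.val).lab)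
  else none

theorem encodeAnswer_answer (I : BinaryGraphicalInstance) :
    I.encodeAnswer (answer I) = answerWord I.edgeList I.val := by
  classical
  have hany : (List.ofFn (greedy I.edgeList I.val).cell).any (fun c => decide (c ≠ .sep)) = true ↔
      ¬ ∀ i, (greedy I.edgeList I.val).cell i = .sep := by
    simp [List.any_eq_true, List.mem_ofFn]
  unfold answer answerWord
  by_cases h : ∀ i, (greedy I.edgeList I.val).cell i = .sep
  · rw [if_pos h, if_neg fun e => hany.1 e h]
    simp only [encodeAnswer, encodeAllocation]
    congr 1
    refine List.flatMap_congr fun p hp => ?_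
    obtain ⟨hlt, hadj⟩ := (I.mem_edgeList p).1 hp
    rw [dif_pos hadj, allocation_edge _ hlt]
  · rw [if_neg h, if_pos (hany.2 h)]
    rfl

theorem n_le_length_encode (I : GraphicalInstance) : I.n ≤ I.encode.length := by
  simp [encode, encodeNat]

theorem length_edgeList_le_length_encode (I : GraphicalInstance) :
    I.edgeList.length ≤ I.encode.length := by
  have h : ∀ P : List (Fin I.n × Fin I.n), P.length ≤ (P.flatMap I.edgeRecord).length := by
    intro P
    induction P with
    | nil => simp
    | cons p P ih =>
      simp only [List.flatMap_cons, List.length_append, List.length_cons, edgeRecord]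
      omega
  rw [encode, List.length_append]
  exact (h _).trans (Nat.le_add_left _ _)

theorem timeBound_le {n m w : ℕ} (hn : n ≤ w) (hm : m ≤ w) :
    timeBound n m + 1 ≤ 100 * (w + 1) ^ 3 := by
  have h : timeBound n m ≤ timeBound w w := by
    unfold timeBound
    gcongr
  refine (Nat.succ_le_succ h).trans ?_
  unfold timeBound
  ring_nf
  omega

theorem computableInPolyTime_answer : ComputableInPolyTime answer := by
  have h (I : BinaryGraphicalInstance) :
      Nonempty (Turing.TM2OutputsInTime (machine mainProg (.side true) .out register₀) I.encode
        (some (I.encodeAnswer (answer I))) ((100 * (Polynomial.X + 1) ^ 3 : Polynomial ℕ).eval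
          I.encode.length)) := by
    obtain ⟨e⟩ := machine_outputsInTime
      (exec_mainProg (nodup_darts_edgeList (I := I.toGraphicalInstance)) I.val)
    rw [← encodeAnswer_answer] at e
    refine ⟨⟨e.toEvalsTo, e.steps_le_m.trans ?_⟩⟩
    have := timeBound_le (n_le_length_encode I.toGraphicalInstance)
      (length_edgeList_le_length_encode I.toGraphicalInstance)
    simpa using this
  refine ⟨{ tm := machine mainProg (.side true) .out register₀
            inputAlphabet := Equiv.refl Symbol
            outputAlphabet := Equiv.refl Symbol
            time := 100 * (Polynomial.X + 1) ^ 3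
            outputsFun := fun I => ?_ }⟩
  have e := (h I).some
  exact cast (congrArg₂ (fun x y => Turing.TM2OutputsInTime
    (machine mainProg (.side true) .out register₀) x (some y) _) (List.map_id _).symm
    (List.map_id _).symm) e

end Instances

end FairDivision

theorem mainTheorem1 :
    ∃ f : (I : FairDivision.BinaryGraphicalInstance) → Option I.Allocation,
      FairDivision.ComputableInPolyTime f ∧
      ∀ I : FairDivision.BinaryGraphicalInstance,
        (∀ Φ : I.Allocation, f I = some Φ → I.IsEF Φ) ∧
        (f I = none → ¬ ∃ Φ : I.Allocation, I.IsEF Φ) := by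
  refine ⟨FairDivision.answer, FairDivision.computableInPolyTime_answer, fun I => ⟨?_, ?_⟩⟩
  · intro Φ hΦ
    unfold FairDivision.answer at hΦ
    split_ifs at hΦ with h
    cases hΦ
    exact FairDivision.isEF_allocation
      (FairDivision.sound_greedy FairDivision.GraphicalInstance.nodup_darts_edgeList
        FairDivision.GraphicalInstance.mem_darts_edgeList (fun i => I.G.irrefl)
        fun i j => FairDivision.encodeValue_ne_tick _) h
  · rintro hnone ⟨Φ, hΦ⟩
    unfold FairDivision.answer at hnone
    rw [if_pos (FairDivision.greedy_cell FairDivision.GraphicalInstance.nodup_darts_edgeList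
      FairDivision.GraphicalInstance.mem_darts_edgeList (fun i => I.G.irrefl)
      (FairDivision.feasible_of_isEF hΦ))] at hnone
    cases hnone
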